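/- Let $a\ge 15$ be an integer and let $\rho,\rho'$ be the real roots of $x^3-ax^2-(a+3)x-1$ with $a+1<\rho$ and $-2<\rho'<-1$; put $K=\mathbb Q(\rho)$, a totally real cubic field containing $\rho'$ (a simplest cubic field). The signature of $\alpha\in K$ is the tuple of signs of $\sigma(\alpha)$, where $\sigma$ runs over the three embeddings $K\to\mathbb R$. For a signature $\mathfrak s$, an element $\alpha\in\mathbb Z[\rho]$ of signature $\mathfrak s$ is called $\mathfrak s$-indecomposable in $\mathbb Z[\rho]$ if it is not the sum of two elements of $\mathbb Z[\rho]$ of signature $\mathfrak s$. Let $\beta^{(k)}=(\beta_1^{(k)},\beta_2^{(k)},\beta_3^{(k)})$, $k\ge 0$, be the (homogeneous) Jacobi–Perron expansion of $(1,-\rho',\rho'^2)$, that is, $\beta^{(0)}=(1,-\rho',\rho'^2)$ and $$\beta^{(k+1)}=\Big(\beta_2^{(k)}-\Big\lfloor\tfrac{\beta_2^{(k)}}{\beta_1^{(k)}}\Big\rfloor\beta_1^{(k)},\ \beta_3^{(k)}-\Big\lfloor\tfrac{\beta_3^{(k)}}{\beta_1^{(k)}}\Big\rfloor\beta_1^{(k)},\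 \beta_1^{(k)}\Big).$$ Let $(p,q)=(2,3)$ or $(p,q)=(3,2)$, let $k\ge 0$, and let $i,j\ge 0$ be integers such that 1. $1\le i\le \big\lfloor \beta_p^{(k)}/\beta_1^{(k)}\big\rfloor-1$; 2. $\beta_p^{(k)}-i\beta_1^{(k)}-j\beta_q^{(k)}$ has the same signature as $\beta_p^{(k)}-i\beta_1^{(k)}$; 3. for every integer $l$ with $i+1\le l\le \big\lfloor \beta_p^{(k)}/\beta_1^{(k)}\big\rfloor-1$, the element $(l-i)\beta_1^{(k)}-\beta_q^{(k)}$ does not have the same signature as $\beta_p^{(k)}-i\beta_1^{(k)}$. Then $\beta_p^{(k)}-i\beta_1^{(k)}-j\beta_q^{(k)}$ is $\mathfrak s$-indecomposable in $\mathbb Z[\rho]$, where $\mathfrak s$ is its signature. Moreover, the elements obtained in this way represent all indecomposables of $\mathbb Z[\rho]$ up to multiplication by units and conjugation: for every signature $\mathfrak s$ and every $\mathfrak s$-indecomposable $\alpha\in\mathbb Z[\rho]$ there are an element $\gamma$ as above, a unit $\varepsilon\in\mathbb Z[\rho]^\times$ and an automorphism $\sigma$ of $K$ with $\alpha=\varepsilon\,\sigma(\gamma)$.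 -/

import Mathlib

open scoped IntermediateField

/-- The signature of an element `x` of a (totally real) field `K`: the tuple of the signs of `σ x`,
where `σ` runs over all the embeddings of `K` into `ℝ`. -/
noncomputable def signature {K : Type*} [Field K] (x : K) : (K →+* ℝ) → SignType :=
  fun σ => SignType.sign (σ x)

/-- `x` is `s`-indecomposable in the order `O`: it lies in `O`, it has signature `s`, and it is not
the sum of two elements of `O` of signature `s`. -/
def IsIndecomposableOfSign {K : Type*} [Field K] (O : Subalgebra ℤ K)
    (s : (K →+* ℝ) → SignType) (x : K) : Prop :=
  (x ∈ O ∧ signature x = s) ∧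
    ¬ ∃ y z : K, (y ∈ O ∧ signature y = s) ∧ (z ∈ O ∧ signature z = s) ∧ x = y + z

/-- One step of the homogeneous Jacobi--Perron algorithm for a vector of real numbers that lie
in a subfield `K` of `ℝ`:
`(β₁, …, βₙ) ↦ (β₂ - ⌊β₂ / β₁⌋ β₁, …, βₙ - ⌊βₙ / β₁⌋ β₁, β₁)`.
The coordinates are numbered from `0`, so that `β 0` is `β₁`. -/
noncomputable def jpaStep {K : IntermediateField ℚ ℝ} {m : ℕ} (β : Fin (m + 1) → K) :
    Fin (m + 1) → K :=
  Fin.snoc (α := fun _ => K)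
    (fun i : Fin m => β i.succ - (⌊((β i.succ / β 0 : K) : ℝ)⌋ : K) * β 0) (β 0)

/-- The Jacobi--Perron expansion `β⁽⁰⁾, β⁽¹⁾, β⁽²⁾, …` of the vector `β = β⁽⁰⁾`. -/
noncomputable def jpaExpansion {K : IntermediateField ℚ ℝ} {m : ℕ} (β : Fin (m + 1) → K) (k : ℕ) :
    Fin (m + 1) → K :=
  jpaStep^[k] β

/-- `x = p - i b - j q` with natural numbers `i`, `j` such that
* `1 ≤ i ≤ ⌊p / b⌋ - 1`,
* `p - i b - j q` has the same signature as `p - i b`,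
* for all `i + 1 ≤ l ≤ ⌊p / b⌋ - 1`, the signatures of `(l - i) b - q` and `p - i b` differ. -/
def IsGeneralizedSemiconvergent {K : IntermediateField ℚ ℝ} (b p q x : K) : Prop :=
  ∃ i j : ℕ,
    (1 ≤ i ∧ (i : ℤ) ≤ ⌊((p / b : K) : ℝ)⌋ - 1) ∧
    signature (p - (i : K) * b - (j : K) * q) = signature (p - (i : K) * b) ∧
    (∀ l : ℕ, i + 1 ≤ l → (l : ℤ) ≤ ⌊((p / b : K) : ℝ)⌋ - 1 →
      signature (((l : K) - (i : K)) * b - q) ≠ signature (p - (i : K) * b)) ∧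
    x = p - (i : K) * b - (j : K) * q

/-- The root `ρ'` of `x³ - a x² - (a + 3) x - 1` lies in the field generated by the root `ρ`. -/
theorem root_mem_adjoin {a : ℤ} {ρ ρ' : ℝ} (ha : -1 ≤ a)
    (hρ : ρ ^ 3 - a * ρ ^ 2 - (a + 3) * ρ - 1 = 0) (hρ₁ : a + 1 < ρ)
    (hρ' : ρ' ^ 3 - a * ρ' ^ 2 - (a + 3) * ρ' - 1 = 0) (h₁ : ρ' < -1) :
    ρ' ∈ ℚ⟮ρ⟯ := by
  have ha' : (-1 : ℝ) ≤ a := by exact_mod_cast ha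
  have hpos : 0 < ρ := by linarith
  have key : ρ' = -1 - ρ⁻¹ := by
    have h : (ρ' - ρ) * (ρ * ρ' + ρ + 1) * ((1 + ρ) * ρ' + 1) = 0 := by
      linear_combination (ρ * (1 + ρ)) * hρ' - (ρ' * (1 + ρ')) * hρ
    have e1 : ρ' - ρ ≠ 0 := by
      intro h; linarith
    have e3 : (1 + ρ) * ρ' + 1 ≠ 0 := by
      intro h; nlinarith
    have e2 : ρ * ρ' + ρ + 1 = 0 := by
      rcases mul_eq_zero.mp h with h | h
      · exact (mul_eq_zero.mp h).resolve_left e1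
      · exact absurd h e3
    field_simp
    linarith
  rw [key]
  exact sub_mem (neg_mem (one_mem _)) (inv_mem (IntermediateField.mem_adjoin_simple_self ℚ ρ))

/-!
Write `g = ρ`, let `τ` be the automorphism with `τ g = ρ' = -1 - 1 / g`, and use coordinates
`x + y g + z g²` on the order `ℤ[g]`. Up to multiplication by units the expansion of
`(1, -ρ', ρ'²)` runs through nine explicit vectors: two initial ones and a period of length seven,
so that the semiconvergents can be listed.

*Indecomposability.* By Euler's formula the trace of `w (x + y g + z g²)`, where
`w = g (g + 1) / (g² + g + 1)²` is the inverse of the derivative of the cubic at `g`, is `z`. As `w`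
is `g (g + 1)` times a square, `z` is a positive integer on all elements having the signature of
`g (g + 1)`, and an element of this signature with `z = 1` cannot be decomposed. Multiplying by
units gives the same criterion for other coordinate functions, and it applies to every
semiconvergent except, up to units, `1 + g + g²`, where three functionals have to be combined.

*Completeness.* Units realise all signatures, so it is enough to treat totally positive elements.
On these `f = x + z ≥ 1`, and the units `g²` and the automorphism `τ` act by `α ↦ g² τ α`. Either
this action strictly lowers `f`, or it can be used to bring the element into the cone spanned by
the totally positive units `1`, `g²` and `g² / (g + 1)²`. There `1` or another totally positive
element can be split off unless `f = 1`, and the points with `f = 1` form a triangle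
`s₁ + s₂ + s₃ = a`, `sᵢ ≥ 0`, permuted cyclically by `g² τ²`; a third of it is filled by the
semiconvergents.
-/

/-! ### Signatures, units and indecomposables -/

section Signature

variable {K : Type*} [Field K] {x y u : K}

theorem signature_eq_iff :
    signature x = signature y ↔ ∀ σ : K →+* ℝ, SignType.sign (σ x) = SignType.sign (σ y) :=
  funext_iff

theorem signature_ne_of_neg_of_pos (σ : K →+* ℝ) (hx : σ x < 0) (hy : 0 < σ y) :
    signature y ≠ signature x := fun h => by
  simpa [sign_pos hy, sign_neg hx] using signature_eq_iff.mp h σ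

theorem signature_mul (x y : K) : signature (x * y) = signature x * signature y := by
  funext σ
  simp only [signature, map_mul, sign_mul, Pi.mul_apply]

theorem signature_mul_left (u : K) (h : signature x = signature y) :
    signature (u * x) = signature (u * y) := by
  rw [signature_mul, signature_mul, h]

theorem signature_mul_left_inj (hu : u ≠ 0) :
    signature (u * x) = signature (u * y) ↔ signature x = signature y := by
  refine ⟨fun h => ?_, signature_mul_left u⟩
  simpa only [inv_mul_cancel_left₀ hu] using signature_mul_left u⁻¹ h

theorem signature_map {F : Type*} [FunLike F K K] [RingHomClass F K K] (τ : F)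
    (h : signature x = signature y) : signature (τ x) = signature (τ y) :=
  signature_eq_iff.mpr fun σ => signature_eq_iff.mp h (σ.comp (τ : K →+* K))

/-- All the conjugates of `x` in `ℝ` are positive. -/
def TotallyPos (x : K) : Prop :=
  ∀ σ : K →+* ℝ, 0 < σ x

theorem totallyPos_iff_signature : TotallyPos x ↔ signature x = signature 1 := by
  simp only [TotallyPos, signature_eq_iff, map_one, sign_one, sign_eq_one_iff]

theorem totallyPos_one : TotallyPos (1 : K) :=
  totallyPos_iff_signature.mpr rfl

theorem totallyPos_sq (hx : x ≠ 0) : TotallyPos (x ^ 2) := fun σ => by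
  rw [map_pow]
  exact sq_pos_of_ne_zero ((map_ne_zero σ).mpr hx)

namespace TotallyPos

theorem add (hx : TotallyPos x) (hy : TotallyPos y) : TotallyPos (x + y) := fun σ => by
  rw [map_add]
  exact add_pos (hx σ) (hy σ)

theorem mul (hx : TotallyPos x) (hy : TotallyPos y) : TotallyPos (x * y) := fun σ => by
  rw [map_mul]
  exact mul_pos (hx σ) (hy σ)

theorem map {F : Type*} [FunLike F K K] [RingHomClass F K K] (hx : TotallyPos x) (τ : F) :
    TotallyPos (τ x) :=
  fun σ => hx (σ.comp (τ : K →+* K))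

theorem of_signature_eq (hy : TotallyPos (u * y)) (h : signature x = signature y) :
    TotallyPos (u * x) := by
  rw [totallyPos_iff_signature] at hy ⊢
  rw [signature_mul_left u h, hy]

theorem signature_eq (hu : u ≠ 0) (hx : TotallyPos (u * x)) (hy : TotallyPos (u * y)) :
    signature x = signature y := by
  rw [totallyPos_iff_signature] at hx hy
  rw [← signature_mul_left_inj hu, hx, hy]

end TotallyPos

end Signature

section Indecomposable

variable {K : Type*} [Field K] {O : Subalgebra ℤ K} {x y u : K}

/-- The elements of `K` that are units of the ring `O`. -/
def orderUnits (O : Subalgebra ℤ K) : Submonoid K :=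
  (IsUnit.submonoid O).map O.val

theorem mem_orderUnits_iff_exists : u ∈ orderUnits O ↔ ∃ ε : Oˣ, ((ε : O) : K) = u := by
  constructor
  · rintro ⟨_, ⟨ε, rfl⟩, rfl⟩
    exact ⟨ε, rfl⟩
  · rintro ⟨ε, rfl⟩
    exact ⟨ε, ε.isUnit, rfl⟩

theorem mem_orderUnits_of_mul_eq_one (hx : x ∈ O) (hy : y ∈ O) (h : x * y = 1) :
    x ∈ orderUnits O :=
  ⟨⟨x, hx⟩, IsUnit.of_mul_eq_one ⟨y, hy⟩ (Subtype.ext h), rfl⟩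

theorem mem_of_mem_orderUnits (hu : u ∈ orderUnits O) : u ∈ O := by
  obtain ⟨v, -, rfl⟩ := hu
  exact v.2

theorem exists_mul_eq_one_of_mem_orderUnits (hu : u ∈ orderUnits O) : ∃ v ∈ O, u * v = 1 := by
  obtain ⟨ε, rfl⟩ := mem_orderUnits_iff_exists.mp hu
  exact ⟨_, (↑ε⁻¹ : O).2, congrArg Subtype.val ε.mul_inv⟩

theorem ne_zero_of_mem_orderUnits (hu : u ∈ orderUnits O) : u ≠ 0 := by
  obtain ⟨v, -, h⟩ := exists_mul_eq_one_of_mem_orderUnits hu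
  exact left_ne_zero_of_mul_eq_one h

theorem inv_mem_orderUnits (hu : u ∈ orderUnits O) : u⁻¹ ∈ orderUnits O := by
  obtain ⟨v, hv, h⟩ := exists_mul_eq_one_of_mem_orderUnits hu
  rw [inv_eq_of_mul_eq_one_right h]
  exact mem_orderUnits_of_mul_eq_one hv (mem_of_mem_orderUnits hu) (mul_comm u v ▸ h)

theorem neg_mem_orderUnits (hu : u ∈ orderUnits O) : -u ∈ orderUnits O := by
  obtain ⟨v, hv, h⟩ := exists_mul_eq_one_of_mem_orderUnits hu
  exact mem_orderUnits_of_mul_eq_one (neg_mem (mem_of_mem_orderUnits hu)) (neg_mem hv)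
    (by rw [neg_mul_neg, h])

theorem map_mem_orderUnits {F : Type*} [FunLike F K K] [RingHomClass F K K] {τ : F}
    (hτ : ∀ y ∈ O, τ y ∈ O) (hu : u ∈ orderUnits O) : τ u ∈ orderUnits O := by
  obtain ⟨v, hv, h⟩ := exists_mul_eq_one_of_mem_orderUnits hu
  exact mem_orderUnits_of_mul_eq_one (hτ u (mem_of_mem_orderUnits hu)) (hτ v hv)
    (by rw [← map_mul, h, map_one])

/-- `x` is indecomposable in `O` for its own signature. -/
def IsIndecomposable (O : Subalgebra ℤ K) (x : K) : Prop :=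
  IsIndecomposableOfSign O (signature x) x

theorem isIndecomposable_iff : IsIndecomposable O x ↔ x ∈ O ∧ ∀ y ∈ O, ∀ z ∈ O,
    signature y = signature x → signature z = signature x → x ≠ y + z := by
  unfold IsIndecomposable IsIndecomposableOfSign
  grind

theorem IsIndecomposable.ne_zero (h : IsIndecomposable O x) : x ≠ 0 := by
  rintro rfl
  exact (isIndecomposable_iff.mp h).2 0 (zero_mem O) 0 (zero_mem O) rfl rfl (add_zero 0).symm

theorem not_isIndecomposable_of_totallyPos_sub (hx : x ∈ O) (hy : y ∈ O) (hpy : TotallyPos y)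
    (hpxy : TotallyPos (x - y)) : ¬ IsIndecomposable O x := fun h => by
  have hpx : TotallyPos x := by simpa using hpy.add hpxy
  rw [totallyPos_iff_signature] at hpx hpy hpxy
  exact (isIndecomposable_iff.mp h).2 y hy (x - y) (sub_mem hx hy) (hpy.trans hpx.symm)
    (hpxy.trans hpx.symm) (add_sub_cancel y x).symm

theorem IsIndecomposable.unit_mul (hu : u ∈ orderUnits O) (hx : IsIndecomposable O x) :
    IsIndecomposable O (u * x) := by
  have hu0 := ne_zero_of_mem_orderUnits hu
  have hinv := mem_of_mem_orderUnits (inv_mem_orderUnits hu)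
  rw [isIndecomposable_iff] at hx ⊢
  refine ⟨mul_mem (mem_of_mem_orderUnits hu) hx.1, fun y hy z hz sy sz e => ?_⟩
  refine hx.2 (u⁻¹ * y) (mul_mem hinv hy) (u⁻¹ * z) (mul_mem hinv hz) ?_ ?_ ?_
  · rw [signature_mul_left _ sy, inv_mul_cancel_left₀ hu0]
  · rw [signature_mul_left _ sz, inv_mul_cancel_left₀ hu0]
  · rw [← mul_add, ← e, inv_mul_cancel_left₀ hu0]

theorem isIndecomposable_unit_mul_iff (hu : u ∈ orderUnits O) :
    IsIndecomposable O (u * x) ↔ IsIndecomposable O x := by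
  refine ⟨fun h => ?_, IsIndecomposable.unit_mul hu⟩
  simpa only [inv_mul_cancel_left₀ (ne_zero_of_mem_orderUnits hu)] using
    h.unit_mul (inv_mem_orderUnits hu)

theorem IsIndecomposable.map {τ : K ≃+* K} (hτ : ∀ y, τ y ∈ O ↔ y ∈ O)
    (hx : IsIndecomposable O x) : IsIndecomposable O (τ x) := by
  rw [isIndecomposable_iff] at hx ⊢
  refine ⟨(hτ x).mpr hx.1, fun y hy z hz sy sz e => ?_⟩
  have mem_symm : ∀ w ∈ O, τ.symm w ∈ O := fun w hw => (hτ _).mp (by rwa [τ.apply_symm_apply])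
  have signature_symm : ∀ w, signature w = signature (τ x) → signature (τ.symm w) = signature x :=
    fun w hw => by simpa using signature_map τ.symm hw
  refine hx.2 _ (mem_symm y hy) _ (mem_symm z hz) (signature_symm y sy) (signature_symm z sz) ?_
  rw [← map_add, ← e, τ.symm_apply_apply]

end Indecomposable

/-! ### The order generated by a root of a simplest cubic -/

/-- The element `x + y g + z g²`. -/
def quadElt {R : Type*} [CommRing R] (g : R) (x y z : ℤ) : R :=
  x + y * g + z * g ^ 2

/-- The sum of the three conjugates of `x`, when `τ` is an automorphism of order three. -/
def conjTrace {K : Type*} [Field K] [Algebra ℚ K] (τ : K ≃ₐ[ℚ] K) (x : K) : K :=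
  x + τ x + τ (τ x)

/-- The element `g` of the real field `K` is the largest root of `x³ - a x² - (a + 3) x - 1`, and
`τ` is the automorphism of `K` that maps `g` to the root `-1 - 1 / g`. -/
structure SimplestCubic {K : IntermediateField ℚ ℝ} (a : ℤ) (g : K) (τ : K ≃ₐ[ℚ] K) : Prop where
  le : 6 ≤ a
  root : g ^ 3 = a * g ^ 2 + (a + 3) * g + 1
  lt : (a : ℝ) + 1 < g
  conj : g * τ g = -(g + 1)

section QuadElt

variable {R : Type*} [CommRing R] (g : R)

theorem self_mem_adjoin : g ∈ Algebra.adjoin ℤ {g} :=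
  Algebra.self_mem_adjoin_singleton ℤ g

theorem quadElt_mem_adjoin (x y z : ℤ) : quadElt g x y z ∈ Algebra.adjoin ℤ {g} :=
  have hg := self_mem_adjoin g
  add_mem (add_mem (intCast_mem _ x) (mul_mem (intCast_mem _ y) hg))
    (mul_mem (intCast_mem _ z) (pow_mem hg 2))

theorem quadElt_add (x y z x' y' z' : ℤ) :
    quadElt g x y z + quadElt g x' y' z' = quadElt g (x + x') (y + y') (z + z') := by
  simp only [quadElt]
  push_cast
  ring

theorem totallyPos_quadElt_one_one_one {K : Type*} [Field K] (g : K) :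
    TotallyPos (quadElt g 1 1 1) := fun σ => by
  simp only [quadElt, Int.cast_one, one_mul, map_add, map_one, map_pow]
  nlinarith [sq_nonneg (σ g + 1)]

end QuadElt

theorem conjTrace_pos {K : IntermediateField ℚ ℝ} (τ : K ≃ₐ[ℚ] K) {x : K} (hx : TotallyPos x) :
    (0 : ℝ) < (conjTrace τ x : K) := by
  have hx₀ : (0 : ℝ) < (x : K) := hx (algebraMap K ℝ)
  have hx₁ : (0 : ℝ) < (τ x : K) := hx.map τ (algebraMap K ℝ)
  have hx₂ : (0 : ℝ) < (τ (τ x) : K) := (hx.map τ).map τ (algebraMap K ℝ)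
  simp only [conjTrace, AddMemClass.coe_add]
  positivity

namespace SimplestCubic

variable {K : IntermediateField ℚ ℝ} {a : ℤ} {g : K} {τ : K ≃ₐ[ℚ] K} {x : K}

section Generator

theorem six_le (h : SimplestCubic a g τ) : (6 : ℝ) ≤ a := by
  exact_mod_cast h.le

theorem gen_pos (h : SimplestCubic a g τ) : (0 : ℝ) < g := by
  linarith [h.six_le, h.lt]

theorem gen_ne_zero (h : SimplestCubic a g τ) : g ≠ 0 := by
  rintro rfl
  simpa using h.gen_pos

theorem gen_add_one_ne_zero (h : SimplestCubic a g τ) : g + 1 ≠ 0 := fun h0 => by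
  have : (g : ℝ) + 1 = 0 := by exact_mod_cast congrArg Subtype.val h0
  linarith [h.gen_pos]

theorem gen_sq_add_gen_add_one_ne_zero (h : SimplestCubic a g τ) : g ^ 2 + g + 1 ≠ 0 := fun h0 => by
  have : (g : ℝ) ^ 2 + g + 1 = 0 := by exact_mod_cast congrArg Subtype.val h0
  nlinarith [h.gen_pos]

theorem gen_mem_orderUnits (h : SimplestCubic a g τ) : g ∈ orderUnits (Algebra.adjoin ℤ {g}) := by
  refine mem_orderUnits_of_mul_eq_one (self_mem_adjoin g)
    (quadElt_mem_adjoin g (-(a + 3)) (-a) 1) ?_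
  simp only [quadElt]
  push_cast
  linear_combination h.root

theorem gen_add_one_mem_orderUnits (h : SimplestCubic a g τ) :
    g + 1 ∈ orderUnits (Algebra.adjoin ℤ {g}) := by
  refine mem_orderUnits_of_mul_eq_one (add_mem (self_mem_adjoin g) (one_mem _))
    (quadElt_mem_adjoin g 2 (a + 1) (-1)) ?_
  simp only [quadElt]
  push_cast
  linear_combination -h.root

theorem map_gen (h : SimplestCubic a g τ) : τ g = -(g + 1) / g := by
  rw [eq_div_iff h.gen_ne_zero, mul_comm, h.conj]

theorem map_map_gen (h : SimplestCubic a g τ) : τ (τ g) = -1 / (g + 1) := by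
  have h0 := h.gen_ne_zero
  have h1 := h.gen_add_one_ne_zero
  rw [h.map_gen, map_div₀, map_neg, map_add, map_one, h.map_gen]
  field_simp
  ring

theorem map_map_map_gen (h : SimplestCubic a g τ) : τ (τ (τ g)) = g := by
  have h0 := h.gen_ne_zero
  rw [h.map_map_gen, map_div₀, map_neg, map_add, map_one, h.map_gen]
  field_simp
  ring

theorem map_root (h : SimplestCubic a g τ) (σ : K →+* ℝ) :
    σ g ^ 3 = a * σ g ^ 2 + (a + 3) * σ g + 1 := by
  simpa only [map_pow, map_add, map_mul, map_intCast, map_ofNat, map_one] using congrArg σ h.root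

end Generator

section Order

theorem mem_adjoin_iff (h : SimplestCubic a g τ) :
    x ∈ Algebra.adjoin ℤ {g} ↔ ∃ p q r : ℤ, x = quadElt g p q r := by
  constructor
  · intro hx
    induction hx using Algebra.adjoin_induction with
    | mem x hx =>
      rw [Set.mem_singleton_iff] at hx
      exact ⟨0, 1, 0, by simp [quadElt, hx]⟩
    | algebraMap n => exact ⟨n, 0, 0, by simp [quadElt]⟩
    | add x y _ _ hx hy =>
      obtain ⟨p, q, r, rfl⟩ := hx
      obtain ⟨p', q', r', rfl⟩ := hy
      exact ⟨_, _, _, quadElt_add g p q r p' q' r'⟩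
    | mul x y _ _ hx hy =>
      obtain ⟨p, q, r, rfl⟩ := hx
      obtain ⟨p', q', r', rfl⟩ := hy
      refine ⟨p * p' + (q * r' + r * q') + r * r' * a,
        p * q' + q * p' + (q * r' + r * q') * (a + 3) + r * r' * (a * (a + 3) + 1),
        p * r' + q * q' + r * p' + (q * r' + r * q') * a + r * r' * (a ^ 2 + a + 3), ?_⟩
      simp only [quadElt]
      push_cast
      linear_combination ((q * r' + r * q' : K) + r * r' * (g + a)) * h.root
  · rintro ⟨p, q, r, rfl⟩
    exact quadElt_mem_adjoin g p q r

theorem map_mem (h : SimplestCubic a g τ) (hx : x ∈ Algebra.adjoin ℤ {g}) :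
    τ x ∈ Algebra.adjoin ℤ {g} := by
  have hg : τ g ∈ Algebra.adjoin ℤ {g} := by
    rw [h.map_gen, div_eq_mul_inv]
    exact mul_mem (neg_mem (mem_of_mem_orderUnits h.gen_add_one_mem_orderUnits))
      (mem_of_mem_orderUnits (inv_mem_orderUnits h.gen_mem_orderUnits))
  obtain ⟨p, q, r, rfl⟩ := h.mem_adjoin_iff.mp hx
  simp only [quadElt, map_add, map_mul, map_pow, map_intCast]
  exact add_mem (add_mem (intCast_mem _ _) (mul_mem (intCast_mem _ _) hg))
    (mul_mem (intCast_mem _ _) (pow_mem hg 2))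

theorem map_map_map (h : SimplestCubic a g τ) (hx : x ∈ Algebra.adjoin ℤ {g}) :
    τ (τ (τ x)) = x := by
  obtain ⟨p, q, r, rfl⟩ := h.mem_adjoin_iff.mp hx
  simp only [quadElt, map_add, map_mul, map_pow, map_intCast, h.map_map_map_gen]

theorem map_mem_iff (h : SimplestCubic a g τ) :
    τ x ∈ Algebra.adjoin ℤ {g} ↔ x ∈ Algebra.adjoin ℤ {g} := by
  refine ⟨fun hx => ?_, h.map_mem⟩
  have hx' := h.map_mem (h.map_mem hx)
  have : τ (τ (τ x)) = x := τ.injective (τ.injective (τ.injective (h.map_map_map hx')))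
  rwa [this] at hx'

theorem isIndecomposable_map (h : SimplestCubic a g τ)
    (hx : IsIndecomposable (Algebra.adjoin ℤ {g}) x) :
    IsIndecomposable (Algebra.adjoin ℤ {g}) (τ x) :=
  IsIndecomposable.map (τ := (τ : K ≃+* K)) (fun _ => h.map_mem_iff) hx

end Order

section Coordinates

theorem conjTrace_mul_quadElt (h : SimplestCubic a g τ) (x y z : ℤ) :
    conjTrace τ (g * (g + 1) / (g ^ 2 + g + 1) ^ 2 * quadElt g x y z) = z := by
  have h0 := h.gen_ne_zero
  have h1 := h.gen_add_one_ne_zero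
  have h2 : g * (g + 1) + 1 ≠ 0 := by
    convert h.gen_sq_add_gen_add_one_ne_zero using 1
    ring
  have map_norm : τ g ^ 2 + τ g + 1 = (g ^ 2 + g + 1) / g ^ 2 := by
    rw [h.map_gen]
    field_simp
    ring
  simp only [conjTrace, quadElt, map_add, map_mul, map_div₀, map_pow, map_one, map_intCast,
    map_norm]
  rw [h.map_map_gen, h.map_gen]
  field_simp
  ring

theorem one_le_lead_of_totallyPos (h : SimplestCubic a g τ) {x y z : ℤ}
    (hp : TotallyPos (g * (g + 1) * quadElt g x y z)) : 1 ≤ z := by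
  have hw := hp.mul (totallyPos_sq (inv_ne_zero h.gen_sq_add_gen_add_one_ne_zero))
  have key : (0 : ℝ) < ((z : K) : ℝ) := by
    rw [← h.conjTrace_mul_quadElt x y z]
    convert conjTrace_pos τ hw using 3
    rw [div_eq_mul_inv, inv_pow]
    ring
  exact_mod_cast key

theorem gen_mul_quadElt (h : SimplestCubic a g τ) (x y z : ℤ) :
    g * quadElt g x y z = quadElt g z (x + (a + 3) * z) (y + a * z) := by
  simp only [quadElt]
  push_cast
  linear_combination (z : K) * h.root

theorem gen_add_one_div_gen_mul_quadElt (h : SimplestCubic a g τ) (x y z : ℤ) :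
    (g + 1) / g * quadElt g x y z =
      quadElt g (y - (a + 2) * x) (y + z - a * x) (x + z) := by
  rw [div_mul_eq_mul_div, div_eq_iff h.gen_ne_zero, mul_comm _ g, h.gen_mul_quadElt]
  simp only [quadElt]
  push_cast
  linear_combination (z : K) * h.root

theorem quadElt_inj (h : SimplestCubic a g τ) {x y z x' y' z' : ℤ}
    (h0 : quadElt g x y z = quadElt g x' y' z') : x = x' ∧ y = y' ∧ z = z' := by
  have lead_eq : ∀ {x y z x' y' z' : ℤ}, quadElt g x y z = quadElt g x' y' z' → z = z' := by
    intro x y z x' y' z' e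
    have := h.conjTrace_mul_quadElt x y z
    rw [e, h.conjTrace_mul_quadElt] at this
    exact_mod_cast this.symm
  have h1 := congrArg (g * ·) h0
  simp only [h.gen_mul_quadElt] at h1
  have h2 := congrArg (g * ·) h1
  simp only [h.gen_mul_quadElt] at h2
  obtain rfl := lead_eq h0
  obtain rfl : y = y' := by simpa using lead_eq h1
  obtain rfl : x = x' := by simpa using lead_eq h2
  exact ⟨rfl, rfl, rfl⟩

theorem one_le_add_of_totallyPos (h : SimplestCubic a g τ) {x y z : ℤ}
    (hp : TotallyPos (quadElt g x y z)) : 1 ≤ x + z := by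
  have hp' := (totallyPos_sq h.gen_add_one_ne_zero).mul hp
  apply h.one_le_lead_of_totallyPos (x := y - (a + 2) * x) (y := y + z - a * x)
  rw [← h.gen_add_one_div_gen_mul_quadElt]
  convert hp' using 1
  field [h.gen_ne_zero]

end Coordinates

section Criteria

theorem isIndecomposable_of_lead_le_one (h : SimplestCubic a g τ) {x y z : ℤ}
    (hp : TotallyPos (g * (g + 1) * quadElt g x y z)) (hz : z ≤ 1) :
    IsIndecomposable (Algebra.adjoin ℤ {g}) (quadElt g x y z) := by
  refine isIndecomposable_iff.mpr ⟨quadElt_mem_adjoin g x y z, ?_⟩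
  intro v hv w hw sv sw e
  obtain ⟨x₁, y₁, z₁, rfl⟩ := h.mem_adjoin_iff.mp hv
  obtain ⟨x₂, y₂, z₂, rfl⟩ := h.mem_adjoin_iff.mp hw
  have hz₁ := h.one_le_lead_of_totallyPos (hp.of_signature_eq sv)
  have hz₂ := h.one_le_lead_of_totallyPos (hp.of_signature_eq sw)
  rw [quadElt_add] at e
  have := h.quadElt_inj e
  omega

theorem isIndecomposable_of_second_le_one (h : SimplestCubic a g τ) {x y z : ℤ}
    (hp : TotallyPos ((g + 1) * quadElt g x y z)) (h1 : y + a * z ≤ 1) :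
    IsIndecomposable (Algebra.adjoin ℤ {g}) (quadElt g x y z) := by
  rw [← isIndecomposable_unit_mul_iff h.gen_mem_orderUnits, h.gen_mul_quadElt]
  refine h.isIndecomposable_of_lead_le_one ?_ h1
  rw [← h.gen_mul_quadElt]
  convert (totallyPos_sq h.gen_ne_zero).mul hp using 1
  ring

theorem isIndecomposable_of_add_le_one (h : SimplestCubic a g τ) {x y z : ℤ}
    (hp : TotallyPos (quadElt g x y z)) (h1 : x + z ≤ 1) :
    IsIndecomposable (Algebra.adjoin ℤ {g}) (quadElt g x y z) := by
  have hu : (g + 1) / g ∈ orderUnits (Algebra.adjoin ℤ {g}) := by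
    rw [div_eq_mul_inv]
    exact mul_mem h.gen_add_one_mem_orderUnits (inv_mem_orderUnits h.gen_mem_orderUnits)
  rw [← isIndecomposable_unit_mul_iff hu, h.gen_add_one_div_gen_mul_quadElt]
  refine h.isIndecomposable_of_lead_le_one ?_ h1
  rw [← h.gen_add_one_div_gen_mul_quadElt]
  convert (totallyPos_sq h.gen_add_one_ne_zero).mul hp using 1
  field [h.gen_ne_zero]

theorem isIndecomposable_of_mem_orderUnits {u : K} (h : SimplestCubic a g τ)
    (hu : u ∈ orderUnits (Algebra.adjoin ℤ {g})) : IsIndecomposable (Algebra.adjoin ℤ {g}) u := by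
  have one_eq : (1 : K) = quadElt g 1 0 0 := by simp [quadElt]
  rw [← mul_one u, isIndecomposable_unit_mul_iff hu, one_eq]
  exact h.isIndecomposable_of_add_le_one (one_eq ▸ totallyPos_one) le_rfl

theorem sq_mul_map_quadElt (h : SimplestCubic a g τ) (x y z : ℤ) :
    g ^ 2 * τ (quadElt g x y z) = quadElt g z (2 * z - y) (x - y + z) := by
  have h0 := h.gen_ne_zero
  simp only [quadElt, map_add, map_mul, map_pow, map_intCast, h.map_gen]
  push_cast
  field_simp
  ring

theorem totallyPos_sq_mul_map (h : SimplestCubic a g τ) {x y z : ℤ}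
    (hp : TotallyPos (quadElt g x y z)) : TotallyPos (quadElt g z (2 * z - y) (x - y + z)) := by
  rw [← h.sq_mul_map_quadElt]
  exact (totallyPos_sq h.gen_ne_zero).mul (hp.map τ)

theorem one_le_cyclic_of_totallyPos (h : SimplestCubic a g τ) {x y z : ℤ}
    (hp : TotallyPos (quadElt g x y z)) :
    1 ≤ x + z ∧ 1 ≤ x - y + 2 * z ∧ 1 ≤ 2 * x - y + z := by
  have h1 := h.one_le_add_of_totallyPos hp
  have h2 := h.one_le_add_of_totallyPos (h.totallyPos_sq_mul_map hp)
  have h3 := h.one_le_add_of_totallyPos (h.totallyPos_sq_mul_map (h.totallyPos_sq_mul_map hp))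
  omega

/- The three functionals of `one_le_cyclic_of_totallyPos` all take the value `2` at `1 + g + g²`:
each summand would have the value `1` at all three, which no integral point attains. -/
theorem isIndecomposable_quadElt_one_one_one (h : SimplestCubic a g τ) :
    IsIndecomposable (Algebra.adjoin ℤ {g}) (quadElt g 1 1 1) := by
  have totallyPos_of_signature : ∀ v : K, signature v = signature (quadElt g 1 1 1) →
      TotallyPos v := fun v hv => by
    rw [totallyPos_iff_signature, hv, ← totallyPos_iff_signature]
    exact totallyPos_quadElt_one_one_one g
  refine isIndecomposable_iff.mpr ⟨quadElt_mem_adjoin g 1 1 1, ?_⟩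
  intro v hv w hw sv sw e
  obtain ⟨x₁, y₁, z₁, rfl⟩ := h.mem_adjoin_iff.mp hv
  obtain ⟨x₂, y₂, z₂, rfl⟩ := h.mem_adjoin_iff.mp hw
  have hv' := h.one_le_cyclic_of_totallyPos (totallyPos_of_signature _ sv)
  have hw' := h.one_le_cyclic_of_totallyPos (totallyPos_of_signature _ sw)
  rw [quadElt_add] at e
  have := h.quadElt_inj e
  omega

end Criteria

end SimplestCubic

/-! ### The Jacobi–Perron expansion -/

section RealRoots

theorem simplestCubic_root_cases {a t : ℝ} (ha : 6 ≤ a)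
    (ht : t ^ 3 = a * t ^ 2 + (a + 3) * t + 1) :
    (a + 1 < t ∧ t < a + 2) ∨ (-2 < t ∧ t < -1) ∨ (-1 < (a + 2) * t ∧ t < 0) := by
  have key : t * (t + 1) * (t - 1 - a) = 2 * t + 1 := by linear_combination ht
  rcases lt_trichotomy t 0 with h0 | rfl | h0
  · rcases lt_trichotomy t (-1) with h1 | rfl | h1
    · have : -2 < t := by
        by_contra! h2
        nlinarith [mul_nonneg (neg_nonneg.mpr h0.le) (neg_nonneg.mpr h0.le),
          mul_nonneg (sub_nonneg.mpr h2) (sub_nonneg.mpr h1.le)]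
      exact .inr (.inl ⟨this, h1⟩)
    · linarith
    · have hpos : 0 < -t * (t + 1) := mul_pos (neg_pos.mpr h0) (by linarith)
      have : -1 < (a + 2) * t := by
        by_contra! h2
        nlinarith [mul_pos hpos (neg_pos.mpr h0)]
      exact .inr (.inr ⟨this, h0⟩)
  · norm_num at ht
  · have hpos : 0 < t * (t + 1) := by positivity
    have h1 : a + 1 < t := by
      by_contra! h2
      nlinarith [mul_nonneg hpos.le (sub_nonneg.mpr h2)]
    have h2 : t < a + 2 := by
      by_contra! h2
      nlinarith [mul_nonneg hpos.le (sub_nonneg.mpr h2)]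
    exact .inl ⟨h1, h2⟩

theorem SimplestCubic.root_cases {K : IntermediateField ℚ ℝ} {a : ℤ} {g : K} {τ : K ≃ₐ[ℚ] K}
    (h : SimplestCubic a g τ) (σ : K →+* ℝ) :
    (a + 1 < σ g ∧ σ g < a + 2) ∨ (-2 < σ g ∧ σ g < -1) ∨
      (-1 < ((a : ℝ) + 2) * σ g ∧ σ g < 0) :=
  simplestCubic_root_cases h.six_le (h.map_root σ)

theorem SimplestCubic.exists_gen_eq {K : IntermediateField ℚ ℝ} {a : ℤ} {g : K} {τ : K ≃ₐ[ℚ] K}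
    (h : SimplestCubic a g τ) :
    ∃ u v : ℝ, 0 < v ∧ v < u ∧ u < 1 / 7 ∧ u < 2 * v ∧ (g : ℝ) = a + 1 + u + v ∧
      (g : ℝ) ^ 2 = (a + 1) * g + 2 - v := by
  have h0 := h.gen_pos
  have hlt := h.lt
  have ha := h.six_le
  have hroot : (g : ℝ) ^ 3 = a * (g : ℝ) ^ 2 + (a + 3) * g + 1 := h.map_root (algebraMap K ℝ)
  have hne : (g : ℝ) + 1 ≠ 0 := by positivity
  refine ⟨1 / g, 1 / (g + 1), by positivity, ?_, ?_, ?_, ?_, ?_⟩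
  · exact one_div_lt_one_div_of_lt h0 (by linarith)
  · exact one_div_lt_one_div_of_lt (by norm_num) (by linarith)
  · rw [← div_eq_mul_one_div, div_lt_div_iff₀ h0 (by positivity)]
    linarith
  · field_simp
    linear_combination hroot
  · field_simp
    linear_combination hroot

end RealRoots

section JacobiPerron

variable {K : IntermediateField ℚ ℝ} {b p q x c : K}

/-- The element `x` is a generalized semiconvergent of the vector `β`, for one of the two choices
`(p, q) = (2, 3)` and `(p, q) = (3, 2)` of the indices. -/
def IsSemiconvergentOf (β : Fin 3 → K) (x : K) : Prop :=
  IsGeneralizedSemiconvergent (β 0) (β 1) (β 2) x ∨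
    IsGeneralizedSemiconvergent (β 0) (β 2) (β 1) x

theorem coe_two : ((2 : K) : ℝ) = 2 := rfl

theorem floor_coe_div {A : ℤ} (hb : (0 : ℝ) < b) (h1 : (A : ℝ) * b ≤ p)
    (h2 : (p : ℝ) < (A + 1) * b) : ⌊((p / b : K) : ℝ)⌋ = A := by
  rw [Int.floor_eq_iff]
  push_cast
  exact ⟨(le_div_iff₀ hb).mpr h1, (div_lt_iff₀ hb).mpr h2⟩

theorem jpaStep_fin_three (β : Fin 3 → K) :
    jpaStep β = ![β 1 - (⌊((β 1 / β 0 : K) : ℝ)⌋ : K) * β 0,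
      β 2 - (⌊((β 2 / β 0 : K) : ℝ)⌋ : K) * β 0, β 0] := by
  funext i
  fin_cases i <;> simp [jpaStep, Fin.snoc]

theorem jpaStep_mul_left {m : ℕ} (hc : c ≠ 0) (β : Fin (m + 1) → K) :
    jpaStep (fun i => c * β i) = fun i => c * jpaStep β i := by
  funext i
  refine Fin.lastCases ?_ (fun i => ?_) i
  · simp [jpaStep]
  · simp only [jpaStep, Fin.snoc_castSucc, mul_div_mul_left _ _ hc]
    ring

theorem isGeneralizedSemiconvergent_iff {A : ℤ} (hA : ⌊((p / b : K) : ℝ)⌋ = A) :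
    IsGeneralizedSemiconvergent b p q x ↔ ∃ i j : ℕ, (1 ≤ i ∧ (i : ℤ) ≤ A - 1) ∧
      signature (p - (i : K) * b - (j : K) * q) = signature (p - (i : K) * b) ∧
      (∀ l : ℕ, i + 1 ≤ l → (l : ℤ) ≤ A - 1 →
        signature (((l : K) - (i : K)) * b - q) ≠ signature (p - (i : K) * b)) ∧
      x = p - (i : K) * b - (j : K) * q := by
  rw [← hA, IsGeneralizedSemiconvergent]

theorem IsGeneralizedSemiconvergent.mul_left (hc : c ≠ 0)
    (h : IsGeneralizedSemiconvergent b p q x) :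
    IsGeneralizedSemiconvergent (c * b) (c * p) (c * q) (c * x) := by
  obtain ⟨i, j, hi, hsign, hl, rfl⟩ := h
  have sub_sub_eq : ∀ y : K,
      c * p - (i : K) * (c * b) - y * (c * q) = c * (p - (i : K) * b - y * q) := fun y => by ring
  have sub_eq : c * p - (i : K) * (c * b) = c * (p - (i : K) * b) := by ring
  refine ⟨i, j, by rwa [mul_div_mul_left _ _ hc], ?_, fun l hil hl' => ?_, (sub_sub_eq _).symm⟩
  · rw [sub_sub_eq, sub_eq, signature_mul_left c hsign]
  · rw [mul_div_mul_left _ _ hc] at hl'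
    have : ((l : K) - i) * (c * b) - c * q = c * (((l : K) - i) * b - q) := by ring
    rw [this, sub_eq, Ne, signature_mul_left_inj hc]
    exact hl l hil hl'

theorem IsSemiconvergentOf.mul_left {β : Fin 3 → K} (hc : c ≠ 0) (h : IsSemiconvergentOf β x) :
    IsSemiconvergentOf (fun i => c * β i) (c * x) :=
  h.imp (.mul_left hc) (.mul_left hc)

/-- Up to units, the vectors that occur in the Jacobi–Perron expansion of `(1, -ρ', ρ'²)`. -/
noncomputable def jpaState (a : ℤ) (g : K) : Fin 9 → Fin 3 → K :=
  ![![g ^ 2, g ^ 2 + g, (g + 1) ^ 2],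
    ![g, 2 * g + 1, g ^ 2],
    ![1, g ^ 2 - (a + 1) * g, g],
    ![g ^ 2 - (a + 1) * g - 1, g - (a + 1), 1],
    ![2 * g + 1, g, g ^ 2],
    ![g, g ^ 2 - (a / 2 : ℤ) * (2 * g + 1), 2 * g + 1],
    ![g ^ 2 - a * g - (a / 2 : ℤ), 1, g],
    ![1, g - (g ^ 2 - a * g - (a / 2 : ℤ)), g ^ 2 - a * g - (a / 2 : ℤ)],
    ![g, g + 1, g ^ 2 + g]]

/-- The integer parts of the quotients of the second by the first coordinates of the vectors
`jpaState a g s`. -/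
def jpaFloorOne (a : ℤ) : Fin 9 → ℤ :=
  ![1, 2, 1, 0, 0, a - 2 * (a / 2), 0, a / 2 - 2, 1]

/-- The integer parts of the quotients of the third by the first coordinates of the vectors
`jpaState a g s`. -/
def jpaFloorTwo (a : ℤ) : Fin 9 → ℤ :=
  ![1, a + 1, a + 1, 1, a / 2, 2, 1, a - a / 2 + 3, a + 2]

/-- The successor of a state: after the first two steps the expansion is periodic, with period
seven, up to units. -/
def nextState : Fin 9 → Fin 9 :=
  ![1, 2, 3, 4, 5, 6, 7, 8, 2]

end JacobiPerron

namespace SimplestCubic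

variable {K : IntermediateField ℚ ℝ} {a : ℤ} {g : K} {τ : K ≃ₐ[ℚ] K}

section JacobiPerron

theorem half_bounds (h : SimplestCubic a g τ) :
    (3 : ℝ) ≤ (a / 2 : ℤ) ∧ (2 : ℝ) * (a / 2 : ℤ) ≤ a ∧ (a : ℝ) ≤ 2 * (a / 2 : ℤ) + 1 := by
  have := h.le
  exact_mod_cast (by omega : 3 ≤ a / 2 ∧ 2 * (a / 2) ≤ a ∧ a ≤ 2 * (a / 2) + 1)

theorem jpaState_zero_pos (h : SimplestCubic a g τ) (s : Fin 9) :
    (0 : ℝ) < (jpaState a g s 0 : K) := by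
  obtain ⟨u, v, hv, hvu, hu, -, hg, hg2⟩ := h.exists_gen_eq
  have h0 := h.gen_pos
  have hm := h.half_bounds
  fin_cases s <;>
    simp only [jpaState, Fin.zero_eta, Fin.mk_one, Fin.reduceFinMk, Matrix.cons_val]
  all_goals push_cast [coe_two]
  all_goals linarith [sq_nonneg (g : ℝ), mul_pos h0 h0]

theorem floor_jpaState_one (h : SimplestCubic a g τ) (s : Fin 9) :
    ⌊((jpaState a g s 1 / jpaState a g s 0 : K) : ℝ)⌋ = jpaFloorOne a s := by
  obtain ⟨u, v, hv, hvu, hu, -, hg, hg2⟩ := h.exists_gen_eq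
  have h0 := h.gen_pos
  have ha := h.six_le
  obtain ⟨hm, hma, -⟩ := h.half_bounds
  have hag := mul_le_mul_of_nonneg_right ha h0.le
  refine floor_coe_div (h.jpaState_zero_pos s) ?_ ?_
  all_goals fin_cases s <;>
    simp only [jpaState, jpaFloorOne, Fin.zero_eta, Fin.mk_one, Fin.reduceFinMk,
      Matrix.cons_val]
  all_goals push_cast [coe_two]
  all_goals linarith

theorem floor_jpaState_two (h : SimplestCubic a g τ) (s : Fin 9) :
    ⌊((jpaState a g s 2 / jpaState a g s 0 : K) : ℝ)⌋ = jpaFloorTwo a s := by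
  obtain ⟨u, v, hv, hvu, hu, -, hg, hg2⟩ := h.exists_gen_eq
  have h0 := h.gen_pos
  have ha := h.six_le
  obtain ⟨hm, hma, ham⟩ := h.half_bounds
  have hag := mul_le_mul_of_nonneg_right ha h0.le
  have hmag := mul_le_mul_of_nonneg_right hma h0.le
  have hamg := mul_le_mul_of_nonneg_right ham h0.le
  refine floor_coe_div (h.jpaState_zero_pos s) ?_ ?_
  all_goals fin_cases s <;>
    simp only [jpaState, jpaFloorTwo, Fin.zero_eta, Fin.mk_one, Fin.reduceFinMk,
      Matrix.cons_val]
  all_goals push_cast [coe_two]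
  all_goals linarith

theorem exists_jpaStep_jpaState (h : SimplestCubic a g τ) (s : Fin 9) :
    ∃ c ∈ orderUnits (Algebra.adjoin ℤ {g}),
      jpaStep (jpaState a g s) = fun i => c * jpaState a g (nextState s) i := by
  have h0 := h.gen_ne_zero
  have h1 := h.gen_add_one_ne_zero
  have hu : (g * (g + 1))⁻¹ ∈ orderUnits (Algebra.adjoin ℤ {g}) :=
    inv_mem_orderUnits (mul_mem h.gen_mem_orderUnits h.gen_add_one_mem_orderUnits)
  refine ⟨if s = 3 ∨ s = 7 then (g * (g + 1))⁻¹ else 1, ?_, ?_⟩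
  · split_ifs
    exacts [hu, one_mem _]
  rw [jpaStep_fin_three, h.floor_jpaState_one, h.floor_jpaState_two]
  funext i
  fin_cases s <;> fin_cases i <;>
    simp only [jpaState, jpaFloorOne, jpaFloorTwo, nextState, Fin.zero_eta, Fin.mk_one,
      Fin.reduceFinMk, Matrix.cons_val, Fin.reduceEq, or_self, or_true, true_or, if_true, if_false,
      one_mul]
  all_goals push_cast
  all_goals try field_simp
  all_goals first
    | ring1
    | linear_combination h.root
    | linear_combination -h.root

theorem exists_jpaExpansion_eq (h : SimplestCubic a g τ) (k : ℕ) :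
    ∃ c ∈ orderUnits (Algebra.adjoin ℤ {g}),
      jpaExpansion ![1, -τ g, τ g ^ 2] k = fun i => c * jpaState a g (nextState^[k] 0) i := by
  induction k with
  | zero =>
    have h0 := h.gen_ne_zero
    refine ⟨(g ^ 2)⁻¹, inv_mem_orderUnits (pow_mem h.gen_mem_orderUnits 2), ?_⟩
    funext i
    fin_cases i <;>
      simp only [jpaExpansion, jpaState, h.map_gen, Function.iterate_zero, id_eq, Fin.zero_eta,
        Fin.mk_one, Fin.reduceFinMk, Matrix.cons_val]
    all_goals field
  | succ k ih =>
    obtain ⟨c, hc, ih⟩ := ih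
    obtain ⟨d, hd, hstep⟩ := h.exists_jpaStep_jpaState (nextState^[k] 0)
    refine ⟨c * d, mul_mem hc hd, ?_⟩
    rw [jpaExpansion] at ih ⊢
    rw [Function.iterate_succ_apply', Function.iterate_succ_apply', ih,
      jpaStep_mul_left (ne_zero_of_mem_orderUnits hc), hstep]
    simp only [mul_assoc]

end JacobiPerron

end SimplestCubic

/-! ### Indecomposability of the semiconvergents -/

namespace SimplestCubic

variable {K : IntermediateField ℚ ℝ} {a : ℤ} {g : K} {τ : K ≃ₐ[ℚ] K} {x : K} {i j : ℕ}

section Semiconvergents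

theorem totallyPos_gen_mul_gen_sub (h : SimplestCubic a g τ) (hi : (i : ℤ) ≤ a + 1) :
    TotallyPos (g * (g - i)) := fun σ => by
  have hi' : (i : ℝ) ≤ a + 1 := by exact_mod_cast hi
  rw [map_mul, map_sub, map_natCast]
  rcases h.root_cases σ with ⟨h1, -⟩ | ⟨-, h1⟩ | ⟨-, h1⟩
  · exact mul_pos (by linarith) (by linarith)
  · exact mul_pos_of_neg_of_neg (by linarith) (by linarith)
  · exact mul_pos_of_neg_of_neg h1 (by linarith)

theorem isIndecomposable_of_signature_eq_gen_mul_gen_sub (h : SimplestCubic a g τ) {x y z : ℤ}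
    (hi : (i : ℤ) ≤ a + 1) (hs : signature (quadElt g x y z) = signature (g * (g - i)))
    (hxz : x + z ≤ 1) : IsIndecomposable (Algebra.adjoin ℤ {g}) (quadElt g x y z) := by
  refine h.isIndecomposable_of_add_le_one ?_ hxz
  rw [totallyPos_iff_signature, hs, ← totallyPos_iff_signature]
  exact h.totallyPos_gen_mul_gen_sub hi

theorem isIndecomposable_of_signature_eq_gen_sq_sub (h : SimplestCubic a g τ)
    (hi : (i : ℤ) ≤ a + 1)
    (hs : signature (g ^ 2 - i * g - j * (2 * g + 1)) = signature (g ^ 2 - i * g)) :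
    IsIndecomposable (Algebra.adjoin ℤ {g}) (g ^ 2 - i * g - j * (2 * g + 1)) := by
  have e : g ^ 2 - i * g - j * (2 * g + 1) = quadElt g (-j) (-i - 2 * j) 1 := by
    simp only [quadElt]
    push_cast
    ring
  have hp : g ^ 2 - i * g = g * (g - i) := by ring
  rw [e] at hs ⊢
  exact h.isIndecomposable_of_signature_eq_gen_mul_gen_sub hi (hp ▸ hs) (by omega)

theorem isIndecomposable_of_signature_eq_gen_sub (h : SimplestCubic a g τ)
    (hi : (i : ℤ) ≤ a + 1)
    (hs : signature (g - i - j * (g ^ 2 - (a + 1) * g)) = signature (g - i)) :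
    IsIndecomposable (Algebra.adjoin ℤ {g}) (g - i - j * (g ^ 2 - (a + 1) * g)) := by
  have e : g * (g - i - j * (g ^ 2 - (a + 1) * g)) =
      quadElt g (-j) (-i - (a + 3) * j) (1 + j) := by
    simp only [quadElt]
    push_cast
    linear_combination -(j : K) * h.root
  have hs' := signature_mul_left g hs
  rw [← isIndecomposable_unit_mul_iff h.gen_mem_orderUnits]
  rw [e] at hs' ⊢
  exact h.isIndecomposable_of_signature_eq_gen_mul_gen_sub hi hs' (by omega)

theorem isIndecomposable_of_signature_eq_gen_sq_add_gen_sub (h : SimplestCubic a g τ)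
    (hi1 : 1 ≤ i) (hi : (i : ℤ) ≤ a + 2)
    (hs : signature (g ^ 2 + g - i * g - j * (g + 1)) = signature (g ^ 2 + g - i * g)) :
    IsIndecomposable (Algebra.adjoin ℤ {g}) (g ^ 2 + g - i * g - j * (g + 1)) := by
  obtain ⟨i, rfl⟩ := Nat.exists_eq_add_of_le' hi1
  have e : g ^ 2 + g - (i + 1 : ℕ) * g - j * (g + 1) = quadElt g (-j) (-i - j) 1 := by
    simp only [quadElt]
    push_cast
    ring
  have hp : g ^ 2 + g - (i + 1 : ℕ) * g = g * (g - i) := by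
    push_cast
    ring
  rw [e] at hs ⊢
  exact h.isIndecomposable_of_signature_eq_gen_mul_gen_sub (by omega) (hp ▸ hs) (by omega)

theorem isIndecomposable_of_signature_eq_gen_add_one (h : SimplestCubic a g τ) {n : ℤ}
    (hn : 2 * n ≤ a)
    (hs : signature (g + 1 - j * (g ^ 2 - n * (2 * g + 1))) = signature (g + 1)) :
    IsIndecomposable (Algebra.adjoin ℤ {g}) (g + 1 - j * (g ^ 2 - n * (2 * g + 1))) := by
  have e : g + 1 - j * (g ^ 2 - n * (2 * g + 1)) = quadElt g (1 + j * n) (1 + 2 * j * n) (-j) := by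
    simp only [quadElt]
    push_cast
    ring
  have hp : TotallyPos ((g + 1) * (g + 1)) := sq (g + 1) ▸ totallyPos_sq h.gen_add_one_ne_zero
  have hq := hp.of_signature_eq hs
  rw [e] at hq ⊢
  refine h.isIndecomposable_of_second_le_one hq ?_
  have : 0 ≤ (j : ℤ) * (a - 2 * n) := mul_nonneg j.cast_nonneg (by omega)
  linarith

theorem totallyPos_mul_gen_sq_sub_mul_two_gen_add_one (h : SimplestCubic a g τ) (hi1 : 1 ≤ i)
    (hi : (i : ℤ) ≤ a / 2) : TotallyPos (g * (g + 1) * (g ^ 2 - i * (2 * g + 1))) := fun σ => by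
  have ha := h.six_le
  have hi1' : (1 : ℝ) ≤ i := by exact_mod_cast hi1
  have hi' : 2 * (i : ℝ) ≤ a := by exact_mod_cast (by omega : 2 * (i : ℤ) ≤ a)
  simp only [map_mul, map_add, map_sub, map_pow, map_one, map_natCast, map_ofNat]
  rcases h.root_cases σ with ⟨h1, h2⟩ | ⟨h1, h2⟩ | ⟨h1, h2⟩
  · refine mul_pos (mul_pos (by linarith) (by linarith)) ?_
    nlinarith
  · refine mul_pos (mul_pos_of_neg_of_neg (by linarith) (by linarith)) ?_
    nlinarith
  · have h3 : -(1 / 8) < σ g := by nlinarith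
    refine mul_pos_of_neg_of_neg (mul_neg_of_neg_of_pos h2 (by linarith)) ?_
    nlinarith

theorem isIndecomposable_of_signature_eq_gen_sq_sub_mul_two_gen_add_one (h : SimplestCubic a g τ)
    (hi1 : 1 ≤ i) (hi : (i : ℤ) ≤ a / 2)
    (hs : signature (g ^ 2 - i * (2 * g + 1) - j * g) = signature (g ^ 2 - i * (2 * g + 1))) :
    IsIndecomposable (Algebra.adjoin ℤ {g}) (g ^ 2 - i * (2 * g + 1) - j * g) := by
  have e : g ^ 2 - i * (2 * g + 1) - j * g = quadElt g (-i) (-2 * i - j) 1 := by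
    simp only [quadElt]
    push_cast
    ring
  have hq := (h.totallyPos_mul_gen_sq_sub_mul_two_gen_add_one hi1 hi).of_signature_eq hs
  rw [e] at hq ⊢
  exact h.isIndecomposable_of_lead_le_one hq le_rfl

theorem totallyPos_gen_add_one_mul_sub (h : SimplestCubic a g τ) (hi1 : 1 ≤ i)
    (hi : (i : ℤ) ≤ a / 2 - 2) :
    TotallyPos ((g + 1) * (g - (g ^ 2 - a * g - (a / 2 : ℤ)) - i)) := fun σ => by
  have ha := h.six_le
  obtain ⟨-, hma, -⟩ := h.half_bounds
  have hi1' : (1 : ℝ) ≤ i := by exact_mod_cast hi1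
  have hi' : (i : ℝ) ≤ (a / 2 : ℤ) - 2 := by exact_mod_cast hi
  simp only [map_mul, map_add, map_sub, map_pow, map_one, map_natCast, map_intCast]
  have e : (σ g + 1) * (σ g - (σ g ^ 2 - a * σ g - (a / 2 : ℤ)) - i) =
      (σ g + 1) * ((a / 2 : ℤ) - 2 - i) + 1 := by linear_combination -h.map_root σ
  rcases h.root_cases σ with ⟨h1, -⟩ | ⟨-, h1⟩ | ⟨h1, h2⟩
  · rw [e]
    have := mul_nonneg (by linarith : 0 ≤ σ g + 1) (sub_nonneg.mpr hi')
    linarith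
  · refine mul_pos_of_neg_of_neg (by linarith) ?_
    nlinarith
  · rw [e]
    have := mul_nonneg (by nlinarith : 0 ≤ σ g + 1) (sub_nonneg.mpr hi')
    linarith

theorem isIndecomposable_of_signature_eq_sub (h : SimplestCubic a g τ) (hi1 : 1 ≤ i)
    (hi : (i : ℤ) ≤ a / 2 - 2)
    (hs : signature (g - (g ^ 2 - a * g - (a / 2 : ℤ)) - i - j * (g ^ 2 - a * g - (a / 2 : ℤ))) =
      signature (g - (g ^ 2 - a * g - (a / 2 : ℤ)) - i)) :
    IsIndecomposable (Algebra.adjoin ℤ {g})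
      (g - (g ^ 2 - a * g - (a / 2 : ℤ)) - i - j * (g ^ 2 - a * g - (a / 2 : ℤ))) := by
  have e : g - (g ^ 2 - a * g - (a / 2 : ℤ)) - i - j * (g ^ 2 - a * g - (a / 2 : ℤ)) =
      quadElt g (a / 2 - i + j * (a / 2)) (1 + a + j * a) (-1 - j) := by
    simp only [quadElt]
    push_cast
    ring
  have hq := (h.totallyPos_gen_add_one_mul_sub hi1 hi).of_signature_eq hs
  rw [e] at hq ⊢
  exact h.isIndecomposable_of_second_le_one hq (by linarith)

theorem totallyPos_mul_gen_sq_sub_sub (h : SimplestCubic a g τ) (hi1 : 1 ≤ i)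
    (hi : (i : ℤ) ≤ a - a / 2 + 2) :
    TotallyPos (g * (g + 1) * (g ^ 2 - a * g - (a / 2 : ℤ) - i)) := fun σ => by
  have ha := h.six_le
  obtain ⟨hm, -, -⟩ := h.half_bounds
  have hi1' : (1 : ℝ) ≤ i := by exact_mod_cast hi1
  have hi' : (i : ℝ) ≤ a - (a / 2 : ℤ) + 2 := by exact_mod_cast hi
  simp only [map_mul, map_add, map_sub, map_pow, map_one, map_natCast, map_intCast]
  have e : σ g * (σ g + 1) * (σ g ^ 2 - a * σ g - (a / 2 : ℤ) - i) =
      σ g * (σ g + 1) * (a - (a / 2 : ℤ) + 2 - i) + (σ g + 1) ^ 2 := by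
    linear_combination (σ g + 1) * h.map_root σ
  have h0 : 0 < (σ g + 1) ^ 2 := by
    simpa using totallyPos_sq h.gen_add_one_ne_zero σ
  rcases h.root_cases σ with ⟨h1, -⟩ | ⟨-, h1⟩ | ⟨h1, h2⟩
  · rw [e]
    have := mul_nonneg (by nlinarith : 0 ≤ σ g * (σ g + 1)) (sub_nonneg.mpr hi')
    linarith
  · rw [e]
    have := mul_nonneg (by nlinarith : 0 ≤ σ g * (σ g + 1)) (sub_nonneg.mpr hi')
    linarith
  · refine mul_pos_of_neg_of_neg (mul_neg_of_neg_of_pos h2 (by nlinarith)) ?_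
    nlinarith

theorem le_of_forall_signature_ne (h : SimplestCubic a g τ) (hi1 : 1 ≤ i)
    (hi : (i : ℤ) ≤ a - a / 2 + 2)
    (hl : ∀ l : ℕ, i + 1 ≤ l → (l : ℤ) ≤ a - a / 2 + 3 - 1 →
      signature (((l : K) - i) - (g - (g ^ 2 - a * g - (a / 2 : ℤ)))) ≠
        signature (g ^ 2 - a * g - (a / 2 : ℤ) - i)) :
    a - 2 * (a / 2) + 4 ≤ (i : ℤ) := by
  have ha := h.le
  by_contra! hlt
  obtain ⟨n, hn⟩ : ∃ n : ℕ, (n : ℤ) = a / 2 - 1 := ⟨(a / 2 - 1).toNat, by omega⟩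
  have hnK : (n : K) = (a / 2 : ℤ) - 1 := by exact_mod_cast congrArg (Int.cast (R := K)) hn
  have hg : g * (g + 1) ≠ 0 := mul_ne_zero h.gen_ne_zero h.gen_add_one_ne_zero
  refine hl (i + n) (by omega) (by push_cast; omega) (TotallyPos.signature_eq hg ?_
    (h.totallyPos_mul_gen_sq_sub_sub hi1 hi))
  convert totallyPos_sq h.gen_ne_zero using 1
  push_cast
  rw [hnK]
  linear_combination g * h.root

theorem eq_of_pos_gen_sq_sub_sub (h : SimplestCubic a g τ)
    (hi : a - 2 * (a / 2) + 4 ≤ (i : ℤ)) (hj : j ≠ 0)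
    (hp : (0 : ℝ) < (g ^ 2 - a * g - (a / 2 : ℤ) - i -
      j * (g - (g ^ 2 - a * g - (a / 2 : ℤ))) : K)) :
    j = 1 ∧ ((i : ℤ) = a - 2 * (a / 2) + 4 ∨ (i : ℤ) = a - 2 * (a / 2) + 5) := by
  obtain ⟨u, v, hv, hvu, hu, huv, hg, hg2⟩ := h.exists_gen_eq
  obtain ⟨hm, -, -⟩ := h.half_bounds
  have hi' : (a : ℝ) - 2 * (a / 2 : ℤ) + 4 ≤ i := by exact_mod_cast hi
  have e : ((g ^ 2 - a * g - (a / 2 : ℤ) - i - j * (g - (g ^ 2 - a * g - (a / 2 : ℤ))) : K) : ℝ) =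
      a + 3 - (a / 2 : ℤ) + u - i - j * ((a / 2 : ℤ) - 2 + v) := by
    push_cast
    linear_combination (1 + (j : ℝ)) * hg2 + hg
  rw [e] at hp
  obtain rfl : j = 1 := by
    by_contra hj1
    have hj2 : (2 : ℝ) ≤ j := by exact_mod_cast (by omega : 2 ≤ j)
    nlinarith [mul_nonneg (sub_nonneg.mpr hj2) (by linarith : 0 ≤ ((a / 2 : ℤ) : ℝ) - 2 + v)]
  refine ⟨rfl, ?_⟩
  have hi5 : (i : ℝ) < a - 2 * (a / 2 : ℤ) + 6 := by
    push_cast at hp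
    linarith
  have : (i : ℤ) < a - 2 * (a / 2) + 6 := by exact_mod_cast hi5
  omega

theorem mul_sub_eq_quadElt_one_one_one (h : SimplestCubic a g τ)
    (hi : (i : ℤ) = a - 2 * (a / 2) + 4) :
    g * (g + 1) * (g ^ 2 - a * g - (a / 2 : ℤ) - i - (g - (g ^ 2 - a * g - (a / 2 : ℤ)))) =
      quadElt g 1 1 1 := by
  have hiK : (i : K) = a - 2 * (a / 2 : ℤ) + 4 := by
    exact_mod_cast congrArg (Int.cast (R := K)) hi
  simp only [quadElt, hiK]
  push_cast
  linear_combination (2 * g + 1) * h.root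

theorem mul_sub_eq_one (h : SimplestCubic a g τ) (hi : (i : ℤ) = a - 2 * (a / 2) + 5) :
    g * (g + 1) * (g ^ 2 - a * g - (a / 2 : ℤ) - i - (g - (g ^ 2 - a * g - (a / 2 : ℤ)))) =
      1 := by
  have hiK : (i : K) = a - 2 * (a / 2 : ℤ) + 5 := by
    exact_mod_cast congrArg (Int.cast (R := K)) hi
  rw [hiK]
  linear_combination (2 * g + 1) * h.root

theorem isIndecomposable_of_signature_eq_gen_sq_sub_sub (h : SimplestCubic a g τ) (hi1 : 1 ≤ i)
    (hi : (i : ℤ) ≤ a - a / 2 + 2)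
    (hs : signature (g ^ 2 - a * g - (a / 2 : ℤ) - i -
      j * (g - (g ^ 2 - a * g - (a / 2 : ℤ)))) = signature (g ^ 2 - a * g - (a / 2 : ℤ) - i))
    (hl : ∀ l : ℕ, i + 1 ≤ l → (l : ℤ) ≤ a - a / 2 + 3 - 1 →
      signature (((l : K) - i) - (g - (g ^ 2 - a * g - (a / 2 : ℤ)))) ≠
        signature (g ^ 2 - a * g - (a / 2 : ℤ) - i)) :
    IsIndecomposable (Algebra.adjoin ℤ {g}) (g ^ 2 - a * g - (a / 2 : ℤ) - i -
      j * (g - (g ^ 2 - a * g - (a / 2 : ℤ)))) := by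
  have hq := (h.totallyPos_mul_gen_sq_sub_sub hi1 hi).of_signature_eq hs
  rcases eq_or_ne j 0 with rfl | hj
  · have e : g ^ 2 - a * g - (a / 2 : ℤ) - i - (0 : ℕ) * (g - (g ^ 2 - a * g - (a / 2 : ℤ))) =
        quadElt g (-(a / 2) - i) (-a) 1 := by
      simp only [quadElt]
      push_cast
      ring
    rw [e] at hq ⊢
    exact h.isIndecomposable_of_lead_le_one hq le_rfl
  · have hg : (0 : ℝ) ≤ (g * (g + 1) : K) := by
      have := h.gen_pos
      push_cast
      positivity
    have hpos := hq (algebraMap K ℝ)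
    rw [map_mul] at hpos
    have hgu := mul_mem h.gen_mem_orderUnits h.gen_add_one_mem_orderUnits
    obtain ⟨rfl, hi4 | hi5⟩ := h.eq_of_pos_gen_sq_sub_sub
      (h.le_of_forall_signature_ne hi1 hi hl) hj (pos_of_mul_pos_right hpos hg)
    all_goals rw [← isIndecomposable_unit_mul_iff hgu, Nat.cast_one, one_mul]
    · rw [h.mul_sub_eq_quadElt_one_one_one hi4]
      exact h.isIndecomposable_quadElt_one_one_one
    · rw [h.mul_sub_eq_one hi5]
      exact h.isIndecomposable_of_mem_orderUnits (one_mem _)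

theorem isIndecomposable_of_semiconvergent_one (h : SimplestCubic a g τ) (s : Fin 9)
    (hx : IsGeneralizedSemiconvergent (jpaState a g s 0) (jpaState a g s 1) (jpaState a g s 2) x) :
    IsIndecomposable (Algebra.adjoin ℤ {g}) x := by
  rw [isGeneralizedSemiconvergent_iff (h.floor_jpaState_one s)] at hx
  obtain ⟨i, j, ⟨hi1, hi⟩, hs, -, rfl⟩ := hx
  have ha := h.le
  fin_cases s <;>
    simp only [jpaState, jpaFloorOne, Fin.zero_eta, Fin.mk_one, Fin.reduceFinMk,
      Matrix.cons_val, mul_one] at hi hs ⊢ <;>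
    try omega
  · obtain rfl : i = 1 := by omega
    have e : 2 * g + 1 - (1 : ℕ) * g = g + 1 := by
      push_cast
      ring
    have e' : g ^ 2 = g ^ 2 - (0 : ℤ) * (2 * g + 1) := by simp
    rw [e, e'] at hs ⊢
    exact h.isIndecomposable_of_signature_eq_gen_add_one (by omega) hs
  · exact h.isIndecomposable_of_signature_eq_sub hi1 (by omega) hs

theorem isIndecomposable_of_semiconvergent_two (h : SimplestCubic a g τ) (s : Fin 9)
    (hx : IsGeneralizedSemiconvergent (jpaState a g s 0) (jpaState a g s 2) (jpaState a g s 1) x) :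
    IsIndecomposable (Algebra.adjoin ℤ {g}) x := by
  rw [isGeneralizedSemiconvergent_iff (h.floor_jpaState_two s)] at hx
  obtain ⟨i, j, ⟨hi1, hi⟩, hs, hl, rfl⟩ := hx
  fin_cases s <;>
    simp only [jpaState, jpaFloorTwo, Fin.zero_eta, Fin.mk_one, Fin.reduceFinMk,
      Matrix.cons_val, mul_one] at hi hs hl ⊢ <;>
    try omega
  · exact h.isIndecomposable_of_signature_eq_gen_sq_sub (by omega) hs
  · exact h.isIndecomposable_of_signature_eq_gen_sub (by omega) hs
  · exact h.isIndecomposable_of_signature_eq_gen_sq_sub_mul_two_gen_add_one hi1 (by omega) hs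
  · obtain rfl : i = 1 := by omega
    have e : 2 * g + 1 - (1 : ℕ) * g = g + 1 := by
      push_cast
      ring
    rw [e] at hs ⊢
    exact h.isIndecomposable_of_signature_eq_gen_add_one (by omega) hs
  · exact h.isIndecomposable_of_signature_eq_gen_sq_sub_sub hi1 (by omega) hs hl
  · exact h.isIndecomposable_of_signature_eq_gen_sq_add_gen_sub hi1 (by omega) hs

theorem isIndecomposable_of_isSemiconvergentOf (h : SimplestCubic a g τ) {k : ℕ}
    (hx : IsSemiconvergentOf (jpaExpansion ![1, -τ g, τ g ^ 2] k) x) :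
    IsIndecomposable (Algebra.adjoin ℤ {g}) x := by
  obtain ⟨c, hc, e⟩ := h.exists_jpaExpansion_eq k
  rw [e] at hx
  have hc0 := ne_zero_of_mem_orderUnits hc
  have hx' := hx.mul_left (inv_ne_zero hc0)
  simp only [inv_mul_cancel_left₀ hc0] at hx'
  rw [← isIndecomposable_unit_mul_iff (inv_mem_orderUnits hc)]
  exact hx'.elim (h.isIndecomposable_of_semiconvergent_one _)
    (h.isIndecomposable_of_semiconvergent_two _)

end Semiconvergents

end SimplestCubic

/-! ### Represented elements -/

theorem pos_of_nonneg_of_add_pos {p q r u v w : ℝ} (hp : 0 ≤ p) (hq : 0 ≤ q) (hr : 0 ≤ r)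
    (hpqr : 0 < p + q + r) (hu : 0 < u) (hv : 0 < v) (hw : 0 < w) :
    0 < p * u + q * v + r * w := by
  have hm : 0 < min u (min v w) := lt_min hu (lt_min hv hw)
  calc 0 < (p + q + r) * min u (min v w) := mul_pos hpqr hm
    _ = p * min u (min v w) + q * min u (min v w) + r * min u (min v w) := by ring
    _ ≤ p * u + q * v + r * w := by gcongr <;> simp

section Represented

variable {K : IntermediateField ℚ ℝ} {g u α : K} {τ : K ≃ₐ[ℚ] K}

/-- The element `α` is, up to a unit of `ℤ[g]` and an automorphism of `K`, a generalized
semiconvergent of the Jacobi–Perron expansion of `(1, -τ g, (τ g)²)`. -/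
def IsRepresented (g : K) (τ : K ≃ₐ[ℚ] K) (α : K) : Prop :=
  ∃ (k : ℕ) (x u : K) (σ : K ≃ₐ[ℚ] K), u ∈ orderUnits (Algebra.adjoin ℤ {g}) ∧
    IsSemiconvergentOf (jpaExpansion ![1, -τ g, τ g ^ 2] k) x ∧ α = u * σ x

/-- The element `α` is no counterexample to the completeness of the list of semiconvergents: if it
is indecomposable in `ℤ[g]`, then it is represented. -/
def IsCovered (g : K) (τ : K ≃ₐ[ℚ] K) (α : K) : Prop :=
  IsIndecomposable (Algebra.adjoin ℤ {g}) α → IsRepresented g τ α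

theorem IsRepresented.unit_mul (hu : u ∈ orderUnits (Algebra.adjoin ℤ {g}))
    (hα : IsRepresented g τ α) : IsRepresented g τ (u * α) := by
  obtain ⟨k, x, v, σ, hv, hx, rfl⟩ := hα
  exact ⟨k, x, u * v, σ, mul_mem hu hv, hx, (mul_assoc u v (σ x)).symm⟩

theorem IsCovered.of_unit_mul (hu : u ∈ orderUnits (Algebra.adjoin ℤ {g}))
    (hα : IsCovered g τ (u * α)) : IsCovered g τ α := fun hi => by
  simpa only [inv_mul_cancel_left₀ (ne_zero_of_mem_orderUnits hu)] using
    (hα (hi.unit_mul hu)).unit_mul (inv_mem_orderUnits hu)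

namespace SimplestCubic

variable {a : ℤ}

theorem isCovered_of_map (h : SimplestCubic a g τ) (hα : IsCovered g τ (τ α)) :
    IsCovered g τ α := fun hi => by
  obtain ⟨k, x, u, σ, hu, hx, e⟩ := hα (h.isIndecomposable_map hi)
  have symm_mem : ∀ y ∈ Algebra.adjoin ℤ {g}, τ.symm y ∈ Algebra.adjoin ℤ {g} := fun y hy =>
    h.map_mem_iff.mp (by rwa [τ.apply_symm_apply])
  refine ⟨k, x, τ.symm u, σ.trans τ.symm, map_mem_orderUnits symm_mem hu, hx, ?_⟩
  rw [← τ.symm_apply_apply α, e, map_mul, AlgEquiv.trans_apply]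

theorem isCovered_of_sq_mul_map (h : SimplestCubic a g τ) (hα : IsCovered g τ (g ^ 2 * τ α)) :
    IsCovered g τ α :=
  h.isCovered_of_map (.of_unit_mul (pow_mem h.gen_mem_orderUnits 2) hα)

theorem isCovered_of_sq_mul_map_map (h : SimplestCubic a g τ)
    (hα : IsCovered g τ (g ^ 2 * τ (τ α))) : IsCovered g τ α :=
  h.isCovered_of_map (h.isCovered_of_map (.of_unit_mul (pow_mem h.gen_mem_orderUnits 2) hα))

theorem isRepresented_of_isSemiconvergentOf_jpaState {x : K} (h : SimplestCubic a g τ) (s : Fin 9)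
    (hx : IsSemiconvergentOf (jpaState a g s) x) : IsRepresented g τ x := by
  have reach : ∀ s : Fin 9, nextState^[s] 0 = s := by decide
  obtain ⟨c, hc, e⟩ := h.exists_jpaExpansion_eq s
  rw [reach] at e
  refine ⟨s, c * x, c⁻¹, .refl, inv_mem_orderUnits hc, ?_, ?_⟩
  · rw [e]
    exact hx.mul_left (ne_zero_of_mem_orderUnits hc)
  · rw [AlgEquiv.coe_refl, id, inv_mul_cancel_left₀ (ne_zero_of_mem_orderUnits hc)]

theorem isRepresented_of_mem_orderUnits (h : SimplestCubic a g τ)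
    (hu : u ∈ orderUnits (Algebra.adjoin ℤ {g})) : IsRepresented g τ u := by
  suffices IsSemiconvergentOf (jpaState a g 1) (g + 1) by
    rw [← inv_mul_cancel_right₀ h.gen_add_one_ne_zero u]
    exact (h.isRepresented_of_isSemiconvergentOf_jpaState 1 this).unit_mul
      (mul_mem hu (inv_mem_orderUnits h.gen_add_one_mem_orderUnits))
  refine .inl ((isGeneralizedSemiconvergent_iff (h.floor_jpaState_one 1)).mpr ⟨1, 0, ?_⟩)
  simp only [jpaState, jpaFloorOne, Matrix.cons_val]
  refine ⟨⟨le_rfl, le_rfl⟩, ?_, fun l hl hl' => by omega, ?_⟩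
  · simp
  · push_cast
    ring

theorem isRepresented_quadElt_one_one_one (h : SimplestCubic a g τ) :
    IsRepresented g τ (quadElt g 1 1 1) := by
  obtain ⟨i, hi⟩ : ∃ i : ℕ, (i : ℤ) = a - 2 * (a / 2) + 4 :=
    Int.eq_ofNat_of_zero_le (by omega) |>.imp fun _ => Eq.symm
  have := h.le
  have hu := mul_mem h.gen_mem_orderUnits h.gen_add_one_mem_orderUnits
  have e := h.mul_sub_eq_quadElt_one_one_one hi
  rw [← e]
  refine (h.isRepresented_of_isSemiconvergentOf_jpaState 7 (.inr ?_)).unit_mul hu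
  refine (isGeneralizedSemiconvergent_iff (h.floor_jpaState_two 7)).mpr ⟨i, 1, ?_⟩
  simp only [jpaState, jpaFloorTwo, Matrix.cons_val, Nat.cast_one, one_mul, mul_one]
  refine ⟨⟨by omega, by omega⟩, ?_, fun l _ hl => ?_, trivial⟩
  · refine TotallyPos.signature_eq (ne_zero_of_mem_orderUnits hu) ?_
      (h.totallyPos_mul_gen_sq_sub_sub (by omega) (by omega))
    rw [e]
    exact totallyPos_quadElt_one_one_one g
  · obtain ⟨u, v, hv, hvu, hu, -, hg, hg2⟩ := h.exists_gen_eq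
    obtain ⟨hm, -, -⟩ := h.half_bounds
    have hi' : (i : ℝ) = a - 2 * (a / 2 : ℤ) + 4 := by exact_mod_cast hi
    have hl' : (l : ℝ) ≤ a - (a / 2 : ℤ) + 3 - 1 := by exact_mod_cast hl
    refine (signature_ne_of_neg_of_pos (algebraMap K ℝ) ?_ ?_).symm
    · change (((l - i - (g - (g ^ 2 - a * g - (a / 2 : ℤ))) : K)) : ℝ) < 0
      push_cast
      linarith
    · change (0 : ℝ) < ((g ^ 2 - a * g - (a / 2 : ℤ) - i : K) : ℝ)
      push_cast
      linarith

theorem coe_map_gen_lt (h : SimplestCubic a g τ) : ((τ g : K) : ℝ) < -1 := by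
  have h0 := h.gen_pos
  rw [h.map_gen]
  push_cast
  rw [div_lt_iff₀ h0]
  linarith

theorem neg_one_lt_coe_map_map_gen (h : SimplestCubic a g τ) : -1 < ((τ (τ g) : K) : ℝ) := by
  have h0 := h.gen_pos
  rw [h.map_map_gen]
  push_cast
  rw [lt_div_iff₀ (by linarith)]
  linarith

theorem coe_map_map_gen_neg (h : SimplestCubic a g τ) : ((τ (τ g) : K) : ℝ) < 0 := by
  have h0 := h.gen_pos
  rw [h.map_map_gen]
  push_cast
  exact div_neg_of_neg_of_pos (by norm_num) (by linarith)

theorem signature_natCast_sub_ne (h : SimplestCubic a g τ) {i l : ℕ} (hi : 1 ≤ i)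
    (hil : i + 1 ≤ l) :
    signature (l - i - (g ^ 2 - (a + 1) * g)) ≠ signature (g - i) := by
  let σ : K →+* ℝ := (algebraMap K ℝ).comp ((τ : K →+* K).comp (τ : K →+* K))
  have h0 : -1 < σ g := h.neg_one_lt_coe_map_map_gen
  have h1 : σ g < 0 := h.coe_map_map_gen_neg
  have hi' : (1 : ℝ) ≤ i := by exact_mod_cast hi
  have hil' : (i : ℝ) + 1 ≤ l := by exact_mod_cast hil
  refine signature_ne_of_neg_of_pos σ ?_ ?_
  · rw [map_sub, map_natCast]
    linarith
  · simp only [map_sub, map_mul, map_add, map_pow, map_natCast, map_intCast, map_one]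
    refine pos_of_mul_pos_right (a := σ g + 1) ?_ (by linarith)
    have : (σ g + 1) * (l - i - (σ g ^ 2 - (a + 1) * σ g)) = (σ g + 1) * (l - i - 1) - σ g := by
      linear_combination -h.map_root σ
    rw [this]
    linarith [mul_nonneg (by linarith : 0 ≤ σ g + 1) (by linarith : (0 : ℝ) ≤ l - i - 1)]

theorem isRepresented_quadElt_neg_natCast (h : SimplestCubic a g τ) {i j : ℕ} (hi : 1 ≤ i)
    (hia : (i : ℤ) ≤ a) (hp : TotallyPos (quadElt g (-j) (-i - (a + 3) * j) (1 + j))) :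
    IsRepresented g τ (quadElt g (-j) (-i - (a + 3) * j) (1 + j)) := by
  have e : quadElt g (-j) (-i - (a + 3) * j) (1 + j) =
      g * (g - i - j * (g ^ 2 - (a + 1) * g)) := by
    simp only [quadElt]
    push_cast
    linear_combination (j : K) * h.root
  rw [e] at hp ⊢
  refine (h.isRepresented_of_isSemiconvergentOf_jpaState 2 (.inr ?_)).unit_mul
    h.gen_mem_orderUnits
  refine (isGeneralizedSemiconvergent_iff (h.floor_jpaState_two 2)).mpr ⟨i, j, ?_⟩
  simp only [jpaState, jpaFloorTwo, Matrix.cons_val, mul_one]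
  refine ⟨⟨hi, by omega⟩, hp.signature_eq h.gen_ne_zero
    (h.totallyPos_gen_mul_gen_sub (by omega)), fun l hil _ => ?_, trivial⟩
  exact h.signature_natCast_sub_ne hi hil

end SimplestCubic

end Represented

/-! ### Totally positive elements -/

section Descent

variable {K : IntermediateField ℚ ℝ} {a : ℤ} {g : K} {τ : K ≃ₐ[ℚ] K}

/-- The element `x + y g + z g²` with `x + z = f` in barycentric coordinates: the numbers
`s₁ = (a + 1) z + y` and `s₂ = -x`, together with `s₃ = a f - s₁ - s₂`, are permuted cyclically by
the action of `g² τ²`. -/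
noncomputable def triElt (a : ℤ) (g : K) (f s₁ s₂ : ℤ) : K :=
  quadElt g (-s₂) (s₁ - (a + 1) * (f + s₂)) (f + s₂)

theorem quadElt_eq_triElt (a : ℤ) (g : K) (x y z : ℤ) :
    quadElt g x y z = triElt a g (x + z) ((a + 1) * z + y) (-x) := by
  unfold triElt
  congr 1 <;> ring

theorem triElt_mem_adjoin (a : ℤ) (g : K) (f s₁ s₂ : ℤ) :
    triElt a g f s₁ s₂ ∈ Algebra.adjoin ℤ {g} :=
  quadElt_mem_adjoin g _ _ _

theorem triElt_sub (a : ℤ) (g : K) (f s₁ s₂ f' s₁' s₂' : ℤ) :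
    triElt a g f s₁ s₂ - triElt a g f' s₁' s₂' = triElt a g (f - f') (s₁ - s₁') (s₂ - s₂') := by
  simp only [triElt, quadElt]
  push_cast
  ring

theorem triElt_one_zero_neg_one (a : ℤ) (g : K) : triElt a g 1 0 (-1) = 1 := by
  simp [triElt, quadElt]

namespace SimplestCubic

variable {f s₁ s₂ s₃ : ℤ}

theorem sq_mul_map_map_triElt (h : SimplestCubic a g τ) (hs : s₁ + s₂ + s₃ = a * f) :
    g ^ 2 * τ (τ (triElt a g f s₁ s₂)) = triElt a g f s₃ s₁ := by
  have h1 := h.gen_add_one_ne_zero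
  obtain rfl : s₃ = a * f - s₁ - s₂ := by omega
  simp only [triElt, quadElt, map_add, map_mul, map_pow, map_intCast, h.map_map_gen]
  push_cast
  field_simp
  linear_combination (-(g + 1) * (s₁ - (a + 1) * (f + s₂)) -
    ((a + 2) * g + (a + 1)) * (f + s₂) : K) * h.root

theorem totallyPos_triElt_rotate (h : SimplestCubic a g τ) (hs : s₁ + s₂ + s₃ = a * f)
    (hp : TotallyPos (triElt a g f s₁ s₂)) : TotallyPos (triElt a g f s₃ s₁) := by
  rw [← h.sq_mul_map_map_triElt hs]
  exact (totallyPos_sq h.gen_ne_zero).mul ((hp.map τ).map τ)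

theorem isCovered_of_triElt_rotate (h : SimplestCubic a g τ) (hs : s₁ + s₂ + s₃ = a * f)
    (hc : IsCovered g τ (triElt a g f s₃ s₁)) : IsCovered g τ (triElt a g f s₁ s₂) :=
  h.isCovered_of_sq_mul_map_map (by rwa [h.sq_mul_map_map_triElt hs])

/- The cone of these inequalities is spanned by `1`, `g²` and `g² / (g + 1)²`. -/
theorem totallyPos_triElt (h : SimplestCubic a g τ) (hs : s₁ + s₂ + s₃ = a * f) (hf : 1 ≤ f)
    (h₁ : s₁ ≤ (a + 1) * (f + s₂)) (h₂ : s₂ ≤ (a + 1) * (f + s₃))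
    (h₃ : s₃ ≤ (a + 1) * (f + s₁)) : TotallyPos (triElt a g f s₁ s₂) := fun σ => by
  have ha := h.six_le
  have hD : (0 : ℝ) < a ^ 2 + 3 * a + 3 := by positivity
  have hσ0 : σ g ≠ 0 := (map_ne_zero σ).mpr h.gen_ne_zero
  have hσ1 : σ g + 1 ≠ 0 := by
    simpa only [map_add, map_one] using (map_ne_zero σ).mpr h.gen_add_one_ne_zero
  have sq_div : (σ g / (σ g + 1)) ^ 2 =
      -(a + 1) - (a ^ 2 + 3 * a + 3) * σ g + (a + 2) * σ g ^ 2 := by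
    rw [div_pow, div_eq_iff (pow_ne_zero 2 hσ1)]
    linear_combination (-(a + 2) * σ g - (a + 1)) * h.map_root σ
  have hs' : (s₁ : ℝ) + s₂ + s₃ = a * f := by exact_mod_cast hs
  have hf' : (1 : ℝ) ≤ f := by exact_mod_cast hf
  have h₁' : (s₁ : ℝ) ≤ (a + 1) * (f + s₂) := by exact_mod_cast h₁
  have h₂' : (s₂ : ℝ) ≤ (a + 1) * (f + s₃) := by exact_mod_cast h₂
  have h₃' : (s₃ : ℝ) ≤ (a + 1) * (f + s₁) := by exact_mod_cast h₃
  refine pos_of_mul_pos_right (a := (a : ℝ) ^ 2 + 3 * a + 3) ?_ hD.le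
  have e : ((a : ℝ) ^ 2 + 3 * a + 3) * σ (triElt a g f s₁ s₂) =
      ((a + 1) * (f + s₃) - s₂) * 1 + ((a + 1) * (f + s₁) - s₃) * σ g ^ 2 +
        ((a + 1) * (f + s₂) - s₁) * (σ g / (σ g + 1)) ^ 2 := by
    rw [sq_div, eq_sub_of_add_eq' hs']
    simp only [triElt, quadElt, map_add, map_mul, map_pow, map_intCast]
    push_cast
    ring
  rw [e]
  refine pos_of_nonneg_of_add_pos (by linarith) (by linarith) (by linarith) ?_ one_pos
    (by positivity) (by positivity)
  calc (0 : ℝ) < (a ^ 2 + 3 * a + 3) * f := mul_pos hD (by linarith)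
    _ = _ := by linear_combination -(a : ℝ) * hs'

theorem totallyPos_triElt_of_nonneg (h : SimplestCubic a g τ) (hs : s₁ + s₂ + s₃ = a * f)
    (hf : 1 ≤ f) (h₁ : 0 ≤ s₁) (h₂ : 0 ≤ s₂) (h₃ : 0 ≤ s₃) :
    TotallyPos (triElt a g f s₁ s₂) := by
  have ha := h.le
  have bound : ∀ s : ℤ, 0 ≤ s → a * f ≤ (a + 1) * (f + s) := fun s hs => by
    nlinarith [mul_nonneg (by omega : 0 ≤ a + 1) hs]
  exact h.totallyPos_triElt hs hf (by linarith [bound s₂ h₂]) (by linarith [bound s₃ h₃])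
    (by linarith [bound s₁ h₁])

theorem isCovered_triElt_of_neg (h : SimplestCubic a g τ) (hs : s₁ + s₂ + s₃ = a * f)
    (hf : 1 ≤ f) (h₁ : s₁ ≤ (a + 1) * (f + s₂)) (h₃ : s₃ ≤ (a + 1) * (f + s₁))
    (h₂ : s₂ < 0) : IsCovered g τ (triElt a g f s₁ s₂) := fun hi => by
  have ha := h.le
  rcases hf.eq_or_lt with rfl | hf
  · have hs₁ : 0 ≤ s₁ := by nlinarith
    have hs₂ : -1 ≤ s₂ := by nlinarith
    obtain rfl : s₂ = -1 := by omega
    obtain rfl : s₁ = 0 := by omega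
    rw [triElt_one_zero_neg_one]
    exact h.isRepresented_of_mem_orderUnits (one_mem _)
  · refine absurd hi (not_isIndecomposable_of_totallyPos_sub (triElt_mem_adjoin a g _ _ _)
      (one_mem _) totallyPos_one ?_)
    rw [← triElt_one_zero_neg_one a g, triElt_sub]
    have hf₃ : a + 1 ≤ f - 1 + s₃ := by nlinarith
    have slack : 0 ≤ (a + 1) * (f - 1 + s₃ - (a + 1)) := mul_nonneg (by omega) (by omega)
    refine h.totallyPos_triElt (s₃ := s₃ - (a + 1)) ?_ (by omega) ?_ ?_ ?_ <;> linarith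

theorem isCovered_triElt_one_of_le (h : SimplestCubic a g τ) (hs : s₁ + s₂ + s₃ = a)
    (h₁ : 0 ≤ s₁) (h₂ : 0 ≤ s₂) (h₂₃ : s₂ ≤ s₃) (h₃ : s₃ < a) :
    IsCovered g τ (triElt a g 1 s₁ s₂) := fun _ => by
  have hp : TotallyPos (triElt a g 1 s₁ s₂) :=
    h.totallyPos_triElt_of_nonneg (by rwa [mul_one]) le_rfl h₁ h₂ (by omega)
  obtain ⟨j, rfl⟩ := Int.eq_ofNat_of_zero_le h₂
  obtain ⟨i, hi⟩ := Int.eq_ofNat_of_zero_le (by omega : 0 ≤ s₃ - j + 1)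
  have e : s₁ - (a + 1) * (1 + (j : ℤ)) = -i - (a + 3) * j := by
    rw [← hi, ← hs]
    ring
  rw [triElt, e] at hp ⊢
  exact h.isRepresented_quadElt_neg_natCast (by omega) (by omega) hp

theorem isCovered_triElt_one (h : SimplestCubic a g τ) (hs : s₁ + s₂ + s₃ = a)
    (h₁ : 0 ≤ s₁) (h₂ : 0 ≤ s₂) (h₃ : 0 ≤ s₃) : IsCovered g τ (triElt a g 1 s₁ s₂) := by
  have ha := h.le
  obtain ⟨h₂₃, h₃'⟩ | ⟨h₁₂, h₂'⟩ | ⟨h₃₁, h₁'⟩ :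
      (s₂ ≤ s₃ ∧ s₃ < a) ∨ (s₁ ≤ s₂ ∧ s₂ < a) ∨ (s₃ ≤ s₁ ∧ s₁ < a) := by omega
  · exact h.isCovered_triElt_one_of_le hs h₁ h₂ h₂₃ h₃'
  · refine h.isCovered_of_triElt_rotate (s₃ := s₃) (by omega) ?_
    exact h.isCovered_triElt_one_of_le (s₃ := s₂) (by omega) h₃ h₁ h₁₂ h₂'
  · refine h.isCovered_of_triElt_rotate (s₃ := s₃) (by omega) ?_
    refine h.isCovered_of_triElt_rotate (s₃ := s₂) (by omega) ?_
    exact h.isCovered_triElt_one_of_le (s₃ := s₁) (by omega) h₂ h₃ h₃₁ h₁'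

theorem isCovered_triElt_of_nonneg (h : SimplestCubic a g τ) (hs : s₁ + s₂ + s₃ = a * f)
    (hf : 1 ≤ f) (h₁ : 0 ≤ s₁) (h₂ : 0 ≤ s₂) (h₃ : 0 ≤ s₃) :
    IsCovered g τ (triElt a g f s₁ s₂) := by
  have ha := h.le
  rcases hf.eq_or_lt with rfl | hf
  · exact h.isCovered_triElt_one (by rwa [mul_one] at hs) h₁ h₂ h₃
  have hge : a ≤ s₁ + s₂ + s₃ := by nlinarith
  obtain ⟨b₁, b₂, b₃, hb, ⟨hb₁, hb₂, hb₃⟩, hb₁', hb₂', hb₃'⟩ :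
      ∃ b₁ b₂ b₃ : ℤ, b₁ + b₂ + b₃ = a ∧ (0 ≤ b₁ ∧ 0 ≤ b₂ ∧ 0 ≤ b₃) ∧
        b₁ ≤ s₁ ∧ b₂ ≤ s₂ ∧ b₃ ≤ s₃ :=
    ⟨min s₁ a, min s₂ (a - min s₁ a), a - min s₁ a - min s₂ (a - min s₁ a), by omega⟩
  refine fun hi => absurd hi (not_isIndecomposable_of_totallyPos_sub
    (y := triElt a g 1 b₁ b₂) (triElt_mem_adjoin a g _ _ _) (triElt_mem_adjoin a g _ _ _) ?_ ?_)
  · exact h.totallyPos_triElt_of_nonneg (by rwa [mul_one]) le_rfl hb₁ hb₂ hb₃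
  · rw [triElt_sub]
    exact h.totallyPos_triElt_of_nonneg (s₃ := s₃ - b₃) (by linarith) (by omega) (by omega)
      (by omega) (by omega)

theorem isCovered_quadElt_of_le (h : SimplestCubic a g τ) {x y z : ℤ} (hy : 0 < y) (hyx : y ≤ x)
    (hyz : y ≤ z) : IsCovered g τ (quadElt g x y z) := fun hi => by
  by_cases h1 : x = 1 ∧ z = 1
  · obtain ⟨rfl, rfl⟩ := h1
    obtain rfl : y = 1 := by omega
    exact h.isRepresented_quadElt_one_one_one
  refine absurd hi (not_isIndecomposable_of_totallyPos_sub (quadElt_mem_adjoin g _ _ _)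
    (quadElt_mem_adjoin g 1 1 1) (totallyPos_quadElt_one_one_one g) fun σ => ?_)
  have hσ0 : σ g ≠ 0 := (map_ne_zero σ).mpr h.gen_ne_zero
  have e : σ (quadElt g x y z - quadElt g 1 1 1) =
      ((y - 1 : ℤ) : ℝ) * ((σ g + 1 / 2) ^ 2 + 3 / 4) + ((x - y : ℤ) : ℝ) * 1 +
        ((z - y : ℤ) : ℝ) * σ g ^ 2 := by
    simp only [quadElt, map_sub, map_add, map_mul, map_pow, map_intCast]
    push_cast
    ring
  rw [e]
  refine pos_of_nonneg_of_add_pos ?_ ?_ ?_ ?_ (by positivity) one_pos (by positivity)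
  all_goals norm_cast
  all_goals omega

theorem isCovered_quadElt_of_pos (h : SimplestCubic a g τ) {x y z : ℤ}
    (ih : ∀ x' y' z' : ℤ, x' + z' < x + z → TotallyPos (quadElt g x' y' z') →
      IsCovered g τ (quadElt g x' y' z'))
    (hp : TotallyPos (quadElt g x y z)) (hy : 0 < y) : IsCovered g τ (quadElt g x y z) := by
  have hp₁ := h.totallyPos_sq_mul_map hp
  have hp₂ := h.totallyPos_sq_mul_map hp₁
  obtain hyz | hyx | ⟨hyx, hyz⟩ : z < y ∨ x < y ∨ (y ≤ x ∧ y ≤ z) := by omega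
  · apply h.isCovered_of_sq_mul_map
    rw [h.sq_mul_map_quadElt]
    exact ih _ _ _ (by omega) hp₁
  · apply h.isCovered_of_sq_mul_map
    rw [h.sq_mul_map_quadElt]
    apply h.isCovered_of_sq_mul_map
    rw [h.sq_mul_map_quadElt]
    exact ih _ _ _ (by omega) hp₂
  · exact h.isCovered_quadElt_of_le hy hyx hyz

theorem isCovered_triElt_of_lt (h : SimplestCubic a g τ)
    (ih : ∀ x y z : ℤ, x + z < f → TotallyPos (quadElt g x y z) → IsCovered g τ (quadElt g x y z))
    (hp : TotallyPos (triElt a g f s₁ s₂)) (h₁ : (a + 1) * (f + s₂) < s₁) :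
    IsCovered g τ (triElt a g f s₁ s₂) :=
  h.isCovered_quadElt_of_pos (fun x y z hxz => ih x y z (by omega)) hp (by omega)

theorem isCovered_triElt_of_le (h : SimplestCubic a g τ) (hs : s₁ + s₂ + s₃ = a * f) (hf : 1 ≤ f)
    (h₁ : s₁ ≤ (a + 1) * (f + s₂)) (h₂ : s₂ ≤ (a + 1) * (f + s₃))
    (h₃ : s₃ ≤ (a + 1) * (f + s₁)) : IsCovered g τ (triElt a g f s₁ s₂) := by
  rcases lt_or_ge s₂ 0 with hs₂ | hs₂
  · exact h.isCovered_triElt_of_neg hs hf h₁ h₃ hs₂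
  rcases lt_or_ge s₁ 0 with hs₁ | hs₁
  · refine h.isCovered_of_triElt_rotate hs ?_
    exact h.isCovered_triElt_of_neg (s₃ := s₂) (by omega) hf h₃ h₂ hs₁
  rcases lt_or_ge s₃ 0 with hs₃ | hs₃
  · refine h.isCovered_of_triElt_rotate hs ?_
    refine h.isCovered_of_triElt_rotate (s₃ := s₂) (by omega) ?_
    exact h.isCovered_triElt_of_neg (s₃ := s₁) (by omega) hf h₂ h₁ hs₃
  · exact h.isCovered_triElt_of_nonneg hs hf hs₁ hs₂ hs₃

theorem isCovered_triElt_of_totallyPos (h : SimplestCubic a g τ) (hs : s₁ + s₂ + s₃ = a * f)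
    (ih : ∀ x y z : ℤ, x + z < f → TotallyPos (quadElt g x y z) → IsCovered g τ (quadElt g x y z))
    (hp : TotallyPos (triElt a g f s₁ s₂)) : IsCovered g τ (triElt a g f s₁ s₂) := by
  have hf : 1 ≤ f := by
    simpa only [neg_add_cancel_comm_assoc] using h.one_le_add_of_totallyPos hp
  have hs' : s₃ + s₁ + s₂ = a * f := by omega
  have hp₁ := h.totallyPos_triElt_rotate hs hp
  have hp₂ := h.totallyPos_triElt_rotate hs' hp₁
  rcases lt_or_ge ((a + 1) * (f + s₂)) s₁ with h₁ | h₁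
  · exact h.isCovered_triElt_of_lt ih hp h₁
  rcases lt_or_ge ((a + 1) * (f + s₁)) s₃ with h₃ | h₃
  · exact h.isCovered_of_triElt_rotate hs (h.isCovered_triElt_of_lt ih hp₁ h₃)
  rcases lt_or_ge ((a + 1) * (f + s₃)) s₂ with h₂ | h₂
  · refine h.isCovered_of_triElt_rotate hs (h.isCovered_of_triElt_rotate hs' ?_)
    exact h.isCovered_triElt_of_lt ih hp₂ h₂
  · exact h.isCovered_triElt_of_le hs hf h₁ h₂ h₃

theorem isCovered_quadElt_of_totallyPos (h : SimplestCubic a g τ) {x y z : ℤ}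
    (hp : TotallyPos (quadElt g x y z)) : IsCovered g τ (quadElt g x y z) := by
  have hxz := h.one_le_add_of_totallyPos hp
  induction hn : (x + z).toNat using Nat.strong_induction_on generalizing x y z with
  | _ n ih =>
  rw [quadElt_eq_triElt a] at hp ⊢
  refine h.isCovered_triElt_of_totallyPos (add_sub_cancel _ _) (fun x' y' z' hlt hp' => ?_) hp
  have hxz' := h.one_le_add_of_totallyPos hp'
  exact ih _ (by omega) hp' hxz' rfl

end SimplestCubic

end Descent

/-! ### Arbitrary signatures -/

section Signs

theorem eq_or_mul_eq_of_simplestCubic_roots {R : Type*} [CommRing R] [NoZeroDivisors R] {a s t : R}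
    (hs : s ^ 3 = a * s ^ 2 + (a + 3) * s + 1) (ht : t ^ 3 = a * t ^ 2 + (a + 3) * t + 1) :
    s = t ∨ s * t = -(t + 1) ∨ s * (t + 1) = -1 := by
  have key : (s - t) * ((s * t + (t + 1)) * (s * (t + 1) + 1)) = 0 := by
    linear_combination (t * (t + 1)) * hs - (s * (s + 1)) * ht
  simpa only [mul_eq_zero, sub_eq_zero, add_eq_zero_iff_eq_neg] using key

namespace SimplestCubic

variable {K : IntermediateField ℚ ℝ} {a : ℤ} {g : K} {τ : K ≃ₐ[ℚ] K} {x : K}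

theorem map_gen_eq (h : SimplestCubic a g τ) (σ : K →+* ℝ) :
    σ g = (g : ℝ) ∨ σ g = (τ g : K) ∨ σ g = (τ (τ g) : K) := by
  have h0 := h.gen_pos
  rw [h.map_map_gen, h.map_gen]
  push_cast
  rw [eq_div_iff h0.ne', eq_div_iff (by positivity)]
  exact eq_or_mul_eq_of_simplestCubic_roots (h.map_root σ) (h.map_root (algebraMap K ℝ))

theorem totallyPos_of_pos (h : SimplestCubic a g τ) (hx : x ∈ Algebra.adjoin ℤ {g})
    (h₀ : (0 : ℝ) < x) (h₁ : (0 : ℝ) < (τ x : K)) (h₂ : (0 : ℝ) < (τ (τ x) : K)) :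
    TotallyPos x := fun σ => by
  have map_eq : ∀ σ' : K →+* ℝ, σ g = σ' g → σ x = σ' x := fun σ' e => by
    obtain ⟨p, q, r, rfl⟩ := h.mem_adjoin_iff.mp hx
    simp only [quadElt, map_add, map_mul, map_pow, map_intCast, e]
  rcases h.map_gen_eq σ with e | e | e
  · rwa [map_eq (algebraMap K ℝ) e]
  · rwa [map_eq ((algebraMap K ℝ).comp (τ : K →+* K)) e]
  · rwa [map_eq ((algebraMap K ℝ).comp ((τ : K →+* K).comp (τ : K →+* K))) e]

theorem exists_mem_orderUnits_mul_pos_of_pos (h : SimplestCubic a g τ) {p q r : ℝ} (hp : 0 < p)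
    (hq : q ≠ 0) (hr : r ≠ 0) : ∃ u ∈ orderUnits (Algebra.adjoin ℤ {g}),
      0 < (u : ℝ) * p ∧ 0 < (τ u : K) * q ∧ 0 < (τ (τ u) : K) * r := by
  have hu := h.gen_mem_orderUnits
  have hu₁ := h.gen_add_one_mem_orderUnits
  have g₀ := h.gen_pos
  have g₁ := h.coe_map_gen_lt
  have g₂ := h.coe_map_map_gen_neg
  have g₂' := h.neg_one_lt_coe_map_map_gen
  rcases hq.lt_or_gt with hq | hq <;> rcases hr.lt_or_gt with hr | hr
  · exact ⟨g, hu, mul_pos g₀ hp, mul_pos_of_neg_of_neg (by linarith) hq,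
      mul_pos_of_neg_of_neg g₂ hr⟩
  · refine ⟨g + 1, hu₁, ?_⟩
    simp only [map_add, map_one]
    push_cast
    exact ⟨mul_pos (by linarith) hp, mul_pos_of_neg_of_neg (by linarith) hq,
      mul_pos (by linarith) hr⟩
  · refine ⟨g * (g + 1), mul_mem hu hu₁, ?_⟩
    simp only [map_mul, map_add, map_one]
    push_cast
    exact ⟨by positivity, mul_pos (mul_pos_of_neg_of_neg (by linarith) (by linarith)) hq,
      mul_pos_of_neg_of_neg (mul_neg_of_neg_of_pos g₂ (by linarith)) hr⟩
  · exact ⟨1, one_mem _, by simpa using hp, by simpa using hq, by simpa using hr⟩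

theorem exists_mem_orderUnits_mul_pos (h : SimplestCubic a g τ) {p q r : ℝ} (hp : p ≠ 0)
    (hq : q ≠ 0) (hr : r ≠ 0) : ∃ u ∈ orderUnits (Algebra.adjoin ℤ {g}),
      0 < (u : ℝ) * p ∧ 0 < (τ u : K) * q ∧ 0 < (τ (τ u) : K) * r := by
  rcases hp.lt_or_gt with hp | hp
  · obtain ⟨u, hu, hup, huq, hur⟩ := h.exists_mem_orderUnits_mul_pos_of_pos (neg_pos.mpr hp)
      (neg_ne_zero.mpr hq) (neg_ne_zero.mpr hr)
    refine ⟨-u, neg_mem_orderUnits hu, ?_⟩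
    simp only [map_neg]
    push_cast
    simp only [neg_mul, mul_neg] at hup huq hur ⊢
    exact ⟨hup, huq, hur⟩
  · exact h.exists_mem_orderUnits_mul_pos_of_pos hp hq hr

theorem exists_mem_orderUnits_totallyPos_mul (h : SimplestCubic a g τ)
    (hx : x ∈ Algebra.adjoin ℤ {g}) (hx0 : x ≠ 0) :
    ∃ u ∈ orderUnits (Algebra.adjoin ℤ {g}), TotallyPos (u * x) := by
  have coe_ne_zero : ∀ y : K, y ≠ 0 → (y : ℝ) ≠ 0 := fun y hy => by exact_mod_cast hy
  have hx1 : τ x ≠ 0 := (map_ne_zero τ).mpr hx0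
  have hx2 : τ (τ x) ≠ 0 := (map_ne_zero τ).mpr hx1
  obtain ⟨u, hu, h₀, h₁, h₂⟩ := h.exists_mem_orderUnits_mul_pos (coe_ne_zero x hx0)
    (coe_ne_zero _ hx1) (coe_ne_zero _ hx2)
  refine ⟨u, hu, h.totallyPos_of_pos (mul_mem (mem_of_mem_orderUnits hu) hx) h₀ ?_ ?_⟩
  · rwa [map_mul]
  · rwa [map_mul, map_mul]

theorem isRepresented_of_isIndecomposable (h : SimplestCubic a g τ)
    (hx : IsIndecomposable (Algebra.adjoin ℤ {g}) x) : IsRepresented g τ x := by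
  have hmem : x ∈ Algebra.adjoin ℤ {g} := hx.1.1
  obtain ⟨u, hu, hp⟩ := h.exists_mem_orderUnits_totallyPos_mul hmem hx.ne_zero
  refine IsCovered.of_unit_mul hu ?_ hx
  obtain ⟨p, q, r, e⟩ := h.mem_adjoin_iff.mp (mul_mem (mem_of_mem_orderUnits hu) hmem)
  rw [e] at hp ⊢
  exact h.isCovered_quadElt_of_totallyPos hp

end SimplestCubic

end Signs

section SimplestCubicField

open Polynomial IntermediateField

/-- The polynomial `x³ - a x² - (a + 3) x - 1` defining the simplest cubic field of parameter
`a`. -/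
noncomputable def simplestCubicPoly (a : ℤ) : ℤ[X] :=
  X ^ 3 - C a * X ^ 2 - C (a + 3) * X - 1

theorem simplestCubicPoly_monic (a : ℤ) : (simplestCubicPoly a).Monic := by
  unfold simplestCubicPoly
  monicity!

theorem aeval_simplestCubicPoly {R : Type*} [CommRing R] (a : ℤ) (x : R) :
    aeval x (simplestCubicPoly a) = x ^ 3 - a * x ^ 2 - (a + 3) * x - 1 := by
  simp only [simplestCubicPoly, map_sub, map_mul, map_pow, map_add, map_one, map_ofNat,
    eq_intCast, map_intCast, aeval_X]

theorem aeval_simplestCubicPoly_intCast_ne_zero (a t : ℤ) :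
    aeval t (simplestCubicPoly a) ≠ 0 := fun ht => by
  rw [aeval_simplestCubicPoly] at ht
  have ht : t * (t ^ 2 - a * t - (a + 3)) = 1 := by
    linear_combination ht
  rcases Int.isUnit_iff.mp (IsUnit.of_mul_eq_one _ ht) with rfl | rfl <;> omega

theorem simplestCubicPoly_map_irreducible (a : ℤ) :
    Irreducible ((simplestCubicPoly a).map (algebraMap ℤ ℚ)) := by
  have hdeg : ((simplestCubicPoly a).map (algebraMap ℤ ℚ)).natDegree = 3 := by
    rw [(simplestCubicPoly_monic a).natDegree_map]
    unfold simplestCubicPoly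
    compute_degree!
  refine irreducible_of_degree_le_three_of_not_isRoot (by rw [hdeg]; simp) fun q hq => ?_
  rw [IsRoot.def, eval_map_algebraMap] at hq
  obtain ⟨t, rfl⟩ := isInteger_of_is_root_of_monic (simplestCubicPoly_monic a) hq
  rw [aeval_algebraMap_eq_zero_iff] at hq
  exact aeval_simplestCubicPoly_intCast_ne_zero a t hq

theorem minpoly_eq_simplestCubicPoly_map {L : Type*} [Field L] [Algebra ℚ L] {a : ℤ} {x : L}
    (hx : aeval x (simplestCubicPoly a) = 0) :
    minpoly ℚ x = (simplestCubicPoly a).map (algebraMap ℤ ℚ) :=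
  (minpoly.eq_of_irreducible_of_monic (simplestCubicPoly_map_irreducible a)
    (by rwa [aeval_map_algebraMap]) ((simplestCubicPoly_monic a).map _)).symm

theorem exists_algEquiv_adjoin_gen_eq {F E : Type*} [Field F] [Field E] [Algebra F E] {x : E}
    (hx : IsIntegral F x) {y : F⟮x⟯} (hy : aeval y (minpoly F x) = 0) :
    ∃ τ : F⟮x⟯ ≃ₐ[F] F⟮x⟯, τ (AdjoinSimple.gen F x) = y := by
  have := adjoin.finiteDimensional hx
  let φ := (algHomAdjoinIntegralEquiv F hx).symm ⟨y, mem_aroots.mpr ⟨minpoly.ne_zero hx, hy⟩⟩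
  exact ⟨.ofBijective φ (Algebra.IsAlgebraic.algHom_bijective φ),
    algHomAdjoinIntegralEquiv_symm_apply_gen F hx _⟩

theorem mul_conjugate_eq {a ρ ρ' : ℝ} (hρ : ρ ^ 3 - a * ρ ^ 2 - (a + 3) * ρ - 1 = 0) (h₀ : 0 < ρ)
    (hρ' : ρ' ^ 3 - a * ρ' ^ 2 - (a + 3) * ρ' - 1 = 0) (h₁ : ρ' < -1) : ρ * ρ' = -(ρ + 1) := by
  have ne₂ : ρ' * (ρ + 1) ≠ -1 := by nlinarith
  have cases := eq_or_mul_eq_of_simplestCubic_roots (a := a) (s := ρ') (t := ρ)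
    (by linear_combination hρ') (by linear_combination hρ)
  rw [mul_comm ρ ρ']
  exact (cases.resolve_left (by linarith)).resolve_right ne₂

theorem exists_simplestCubic {a : ℤ} (ha : 6 ≤ a) {ρ : ℝ}
    (hρ : ρ ^ 3 - a * ρ ^ 2 - (a + 3) * ρ - 1 = 0) (hρ₁ : a + 1 < ρ) {r : ℚ⟮ρ⟯}
    (hr : (r : ℝ) ^ 3 - a * r ^ 2 - (a + 3) * r - 1 = 0) (hr₁ : (r : ℝ) < -1) :
    ∃ τ : ℚ⟮ρ⟯ ≃ₐ[ℚ] ℚ⟮ρ⟯, SimplestCubic a (AdjoinSimple.gen ℚ ρ) τ ∧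
      τ (AdjoinSimple.gen ℚ ρ) = r := by
  have hρ0 : aeval ρ (simplestCubicPoly a) = 0 := by rwa [aeval_simplestCubicPoly]
  have hr0 : aeval r (simplestCubicPoly a) = 0 := by
    rw [aeval_simplestCubicPoly]
    exact Subtype.ext hr
  have hmin := minpoly_eq_simplestCubicPoly_map hρ0
  have hint : IsIntegral ℚ ρ := .tower_top ⟨_, simplestCubicPoly_monic a, hρ0⟩
  obtain ⟨τ, rfl⟩ := exists_algEquiv_adjoin_gen_eq hint (y := r)
    (by rwa [hmin, aeval_map_algebraMap])
  have hρ_pos : 0 < ρ := by linarith [show (6 : ℝ) ≤ a by exact_mod_cast ha]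
  have root : AdjoinSimple.gen ℚ ρ ^ 3 - a * AdjoinSimple.gen ℚ ρ ^ 2 -
      (a + 3) * AdjoinSimple.gen ℚ ρ - 1 = 0 := Subtype.ext hρ
  exact ⟨τ, ⟨ha, by linear_combination root, hρ₁,
    Subtype.ext (mul_conjugate_eq hρ hρ_pos hr hr₁)⟩, rfl⟩

end SimplestCubicField

theorem mainTheorem8_general (a : ℤ) (ha : 6 ≤ a) (ρ ρ' : ℝ)
    (hρ : ρ ^ 3 - a * ρ ^ 2 - (a + 3) * ρ - 1 = 0) (hρ₁ : a + 1 < ρ)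
    (hρ' : ρ' ^ 3 - a * ρ' ^ 2 - (a + 3) * ρ' - 1 = 0) (h₁ : ρ' < -1) :
    let O : Subalgebra ℤ ℚ⟮ρ⟯ := Algebra.adjoin ℤ {IntermediateField.AdjoinSimple.gen ℚ ρ}
    let r : ℚ⟮ρ⟯ := ⟨ρ', root_mem_adjoin (by omega) hρ hρ₁ hρ' h₁⟩
    let β : ℕ → Fin 3 → ℚ⟮ρ⟯ := jpaExpansion ![1, -r, r ^ 2]
    (∀ (k : ℕ) (x : ℚ⟮ρ⟯), IsGeneralizedSemiconvergent (β k 0) (β k 1) (β k 2) x →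
      IsIndecomposableOfSign O (signature x) x) ∧
    (∀ (k : ℕ) (x : ℚ⟮ρ⟯), IsGeneralizedSemiconvergent (β k 0) (β k 2) (β k 1) x →
      IsIndecomposableOfSign O (signature x) x) ∧
    (∀ (s : (ℚ⟮ρ⟯ →+* ℝ) → SignType) (α : ℚ⟮ρ⟯), IsIndecomposableOfSign O s α →
      ∃ (k : ℕ) (x : ℚ⟮ρ⟯) (ε : Oˣ) (σ : ℚ⟮ρ⟯ ≃ₐ[ℚ] ℚ⟮ρ⟯),
        (IsGeneralizedSemiconvergent (β k 0) (β k 1) (β k 2) x ∨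
          IsGeneralizedSemiconvergent (β k 0) (β k 2) (β k 1) x) ∧
        α = ((ε : O) : ℚ⟮ρ⟯) * σ x) := by
  intro O r β
  obtain ⟨τ, h, hr⟩ := exists_simplestCubic ha hρ hρ₁ (r := r) hρ' h₁
  rw [show β = jpaExpansion ![1, -r, r ^ 2] from rfl, ← hr]
  refine ⟨fun k x hx => h.isIndecomposable_of_isSemiconvergentOf (.inl hx),
    fun k x hx => h.isIndecomposable_of_isSemiconvergentOf (.inr hx), fun s α hα => ?_⟩
  obtain ⟨-, rfl⟩ := hα.1
  obtain ⟨k, x, u, σ, hu, hx, e⟩ := h.isRepresented_of_isIndecomposable hα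
  obtain ⟨ε, rfl⟩ := mem_orderUnits_iff_exists.mp hu
  exact ⟨k, x, ε, σ, hx, e⟩

theorem mainTheorem8 (a : ℤ) (ha : 15 ≤ a) (ρ ρ' : ℝ)
    (hρ : ρ ^ 3 - a * ρ ^ 2 - (a + 3) * ρ - 1 = 0) (hρ₁ : a + 1 < ρ)
    (hρ' : ρ' ^ 3 - a * ρ' ^ 2 - (a + 3) * ρ' - 1 = 0) (h₂ : -2 < ρ') (h₁ : ρ' < -1) :
    -- the order `ℤ[ρ]`, the conjugate `ρ'` and the expansion of `(1, -ρ', ρ'²)` in `ℚ(ρ)`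
    let O : Subalgebra ℤ ℚ⟮ρ⟯ := Algebra.adjoin ℤ {IntermediateField.AdjoinSimple.gen ℚ ρ}
    let r : ℚ⟮ρ⟯ := ⟨ρ', root_mem_adjoin (by omega) hρ hρ₁ hρ' h₁⟩
    let β : ℕ → Fin 3 → ℚ⟮ρ⟯ := jpaExpansion ![1, -r, r ^ 2]
    (∀ (k : ℕ) (x : ℚ⟮ρ⟯), IsGeneralizedSemiconvergent (β k 0) (β k 1) (β k 2) x →
      IsIndecomposableOfSign O (signature x) x) ∧
    (∀ (k : ℕ) (x : ℚ⟮ρ⟯), IsGeneralizedSemiconvergent (β k 0) (β k 2) (β k 1) x →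
      IsIndecomposableOfSign O (signature x) x) ∧
    (∀ (s : (ℚ⟮ρ⟯ →+* ℝ) → SignType) (α : ℚ⟮ρ⟯), IsIndecomposableOfSign O s α →
      ∃ (k : ℕ) (x : ℚ⟮ρ⟯) (ε : Oˣ) (σ : ℚ⟮ρ⟯ ≃ₐ[ℚ] ℚ⟮ρ⟯),
        (IsGeneralizedSemiconvergent (β k 0) (β k 1) (β k 2) x ∨
          IsGeneralizedSemiconvergent (β k 0) (β k 2) (β k 1) x) ∧
        α = ((ε : O) : ℚ⟮ρ⟯) * σ x) :=
  mainTheorem8_general a (by omega) ρ ρ' hρ hρ₁ hρ' h₁
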